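/- A simplicial complex on $n$ vertices is a family $\mathcal F$ of subsets of $[n]=\{1,\dots,n\}$ that is closed under taking subsets; it is a simplicial $d$-complex if the maximum size of a set in $\mathcal F$ is $d+1$. The dual graph of a simplicial $d$-complex $\mathcal F$ has as vertices all sets in $\mathcal F$ of size $d+1$, two of them being adjacent if their intersection has size $d$, and the diameter of $\mathcal F$ is the diameter of its dual graph. Let $H_s(n,d)$ be the maximum diameter of a simplicial $d$-complex on $n$ vertices with a connected dual graph. Theorem. For every integer $n\ge 3$ this maximum exists for $d=2$, and $$H_s(n,2)=\begin{cases}\left\lfloor \frac12\binom n2-\frac32\right\rfloor & \text{if } n\neq 6,\\[2pt] 5=\left\lfloor \frac12\binom 62-\frac32\right\rfloor-1 & \text{if } n=6.\end{cases}$$ -/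

import Mathlib

/-- A simplicial complex on the vertex set `Fin n` (not every vertex has to be used) is a
`d`-complex if the maximum size of a face is `d + 1`. -/
def IsSimplicialDComplex {n : ℕ} (d : ℕ) (K : PreAbstractSimplicialComplex (Fin n)) : Prop :=
  IsGreatest (Finset.card '' K.faces) (d + 1)

/-- The dual graph of a simplicial `d`-complex: its vertices are the faces of size `d + 1`, and
two of them are adjacent if their intersection has size `d`. -/
def dualGraph {n : ℕ} (d : ℕ) (K : PreAbstractSimplicialComplex (Fin n)) :
    SimpleGraph {s : Finset (Fin n) // s ∈ K.faces ∧ s.card = d + 1} where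
  Adj s t := (s.1 ∩ t.1).card = d
  symm := ⟨fun s t h => by rw [Finset.inter_comm]; exact h⟩
  loopless := ⟨fun s h => by
    have h2 := s.2.2
    rw [Finset.inter_self] at h
    omega⟩

/-- The set of all diameters of simplicial `d`-complexes on `n` vertices with a connected
dual graph. The diameter of a complex is the diameter of its dual graph. -/
def simplicialDiameters (n d : ℕ) : Set ℕ :=
  {D | ∃ K : PreAbstractSimplicialComplex (Fin n),
    IsSimplicialDComplex d K ∧ (dualGraph d K).Connected ∧ (dualGraph d K).diam = D}

/-- `Hs n d` is the maximum diameter of a simplicial `d`-complex on `n` vertices with a connected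
dual graph (written as a supremum of natural numbers). -/
noncomputable def Hs (n d : ℕ) : ℕ := sSup (simplicialDiameters n d)

/-! Upper bound. A shortest path realizing the diameter `D` consists of `D + 1` triangles;
consecutive ones share two vertices, all others at most one. The first triangle contributes three
pairs of vertices and each later one two new pairs, so 2D + 3 ≤ C(n,2)
(`le_of_mem_simplicialDiameters`). For n = 6 and D = 6 all 15 pairs would be used, which a count
around each vertex excludes (`six_notMem_simplicialDiameters_six`).

Lower bound. A strip, in which every triangle is glued to an edge of its predecessor at the newest
vertex, has at most 2N + 1 edges if it has N triangles. If it covers all pairs but g of them and 2N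
+ 1 + g ≤ C(n,2), then no edge can repeat, and this forces an induced path, of diameter N - 1
(`isInducedTrianglePath_of_cover`). It remains to find strips missing no pair (C(n,2) odd) or one
pair (C(n,2) even).

For large n they come from a closed strip on `ZMod m` invariant under translation by a unit `s`
(`IsWheel`): p triangles surround each hub c, with spokes to the points c + x i, and then the strip
passes to the hub c + s. Up to sign, its edges have 2p differences: the x i, the x (i + 1) - x i,
and s. Deleting one triangle opens the strip and loses only one rim edge. If m = 4p + 1, these are
all the differences. If m = 4p + 3, 4p + 5 or 4p + 7, then one, two or three differences remain;
each is a unit, so its edges form a Hamilton cycle, most of which is covered by a fan whose apex is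
a new point. A few linking triangles join the pieces and, in the last two cases, recover the rim
edge. The resulting n = 4p + 1, 4p + 4, 4p + 7, 4p + 10 meet all residues modulo 4. The sequences x
zigzag between the ends of an interval, so that terms fill the large residues and differences the
small ones; a few exceptional terms fill the gaps. Small cases are given explicitly. -/

/-! ### Induced paths of triangles and the diameter -/

/-- A finite sequence of triangles is an induced path if two of its members share two vertices
exactly when they are consecutive. -/
def IsInducedTrianglePath {V : Type*} [DecidableEq V] (l : ℕ) (A : Fin l → Finset V) : Prop :=
  (∀ k, (A k).card = 3) ∧ Function.Injective A ∧
    ∀ j k, (A j ∩ A k).card = 2 ↔ (j : ℕ) + 1 = k ∨ (k : ℕ) + 1 = j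

theorem IsInducedTrianglePath.map {V W : Type*} [DecidableEq V] [DecidableEq W] {l : ℕ}
    {A : Fin l → Finset V} (h : IsInducedTrianglePath l A) (e : V ≃ W) :
    IsInducedTrianglePath l (fun k => (A k).map e.toEmbedding) := by
  refine ⟨fun k => by simp [h.1 k], fun j k hjk => h.2.1 ?_, fun j k => ?_⟩
  · exact Finset.map_injective _ hjk
  · rw [← h.2.2 j k, ← Finset.map_inter, Finset.card_map]

/-- The complex of all nonempty subsets of the members of a family. -/
def generatedComplex {V : Type*} {ι : Type*} (A : ι → Finset V) :
    PreAbstractSimplicialComplex V where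
  faces := {s | s.Nonempty ∧ ∃ k, s ⊆ A k}
  isRelLowerSet_faces := by
    rintro s ⟨hs, k, hk⟩
    exact ⟨hs, fun t hts ht => ⟨ht, k, hts.trans hk⟩⟩

/-- The generated complex has no triangles besides the members of the family, so its dual graph is a
path with `l` edges. -/
theorem IsInducedTrianglePath.diameter_mem {n l : ℕ} {A : Fin (l + 1) → Finset (Fin n)}
    (h : IsInducedTrianglePath (l + 1) A) : l ∈ simplicialDiameters n 2 := by
  obtain ⟨h3, hinj, hadj⟩ := h
  have hne : ∀ k, (A k).Nonempty := fun k => Finset.card_pos.1 (by rw [h3 k]; norm_num)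
  let K := generatedComplex A
  have hK : ∀ k, A k ∈ K.faces := fun k => ⟨hne k, k, subset_rfl⟩
  let a : Fin (l + 1) → {s : Finset (Fin n) // s ∈ K.faces ∧ s.card = 2 + 1} :=
    fun k => ⟨A k, hK k, h3 k⟩
  have hsurj : ∀ s, ∃ k, a k = s := by
    rintro ⟨s, ⟨hs, k, hk⟩, hc⟩
    refine ⟨k, Subtype.ext ?_⟩
    exact (Finset.eq_of_subset_of_card_le hk (by rw [h3 k, hc])).symm
  have hainj : Function.Injective a := fun j k hjk => hinj (congrArg Subtype.val hjk)
  have haadj : ∀ j k, (dualGraph 2 K).Adj (a j) (a k) ↔ (j : ℕ) + 1 = k ∨ (k : ℕ) + 1 = j :=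
    fun j k => hadj j k
  have hwalk : ∀ (d i : ℕ) (hi : i + d < l + 1),
      ∃ w : (dualGraph 2 K).Walk (a ⟨i, by omega⟩) (a ⟨i + d, hi⟩), w.length = d := by
    intro d
    induction d with
    | zero => exact fun i hi => ⟨SimpleGraph.Walk.nil, rfl⟩
    | succ d ih =>
      intro i hi
      obtain ⟨w, hw⟩ := ih i (by omega)
      have hstep : (dualGraph 2 K).Adj (a ⟨i + d, by omega⟩) (a ⟨i + (d + 1), hi⟩) :=
        (haadj _ _).2 (Or.inl (by simp; omega))
      exact ⟨w.concat hstep, by rw [SimpleGraph.Walk.length_concat, hw]⟩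
  have hle : ∀ j k : Fin (l + 1), (j : ℕ) ≤ k → (dualGraph 2 K).Reachable (a j) (a k) ∧
      (dualGraph 2 K).dist (a j) (a k) ≤ l := by
    intro j k hjk
    have hk : (⟨(j : ℕ) + ((k : ℕ) - j), by omega⟩ : Fin (l + 1)) = k := Fin.ext (by simp; omega)
    obtain ⟨w, hw⟩ : ∃ w : (dualGraph 2 K).Walk (a j) (a k), w.length = k - j := by
      have := hwalk (k - j) j (by omega)
      rwa [hk] at this
    exact ⟨⟨w⟩, (SimpleGraph.dist_le w).trans (by omega)⟩
  have hreach : ∀ s t, (dualGraph 2 K).Reachable s t ∧ (dualGraph 2 K).dist s t ≤ l := by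
    intro s t
    obtain ⟨j, rfl⟩ := hsurj s
    obtain ⟨k, rfl⟩ := hsurj t
    rcases le_total (j : ℕ) k with hjk | hjk
    · exact hle j k hjk
    · rw [SimpleGraph.dist_comm]
      exact ⟨(hle k j hjk).1.symm, (hle k j hjk).2⟩
  have hconn : (dualGraph 2 K).Connected :=
    { preconnected := fun s t => (hreach s t).1, nonempty := ⟨a 0⟩ }
  -- An adjacency changes the index by exactly one, so a walk cannot advance it by more than its
  -- length. This bounds the diameter from below.
  have hindex : ∀ (s t) (w : (dualGraph 2 K).Walk s t) (j k : Fin (l + 1)),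
      a j = s → a k = t → (k : ℕ) ≤ j + w.length := by
    intro s t w
    induction w with
    | nil =>
      intro j k hj hk
      rw [hainj (hj.trans hk.symm)]
      omega
    | cons hst w ih =>
      intro j k hj hk
      rename_i u v w'
      obtain ⟨i, rfl⟩ := hsurj v
      subst hj
      have h1 := ih i k rfl hk
      have h2 := (haadj j i).1 hst
      rw [SimpleGraph.Walk.length_cons]
      omega
  refine ⟨K, ⟨⟨A 0, hK 0, h3 0⟩, ?_⟩, hconn, ?_⟩
  · rintro _ ⟨s, ⟨_, k, hk⟩, rfl⟩
    exact (Finset.card_le_card hk).trans (h3 k).le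
  · have := hconn.nonempty
    apply le_antisymm
    · obtain ⟨u, v, huv⟩ := (dualGraph 2 K).exists_dist_eq_diam
      rw [← huv]
      exact (hreach u v).2
    · have hfin : (dualGraph 2 K).ediam ≠ ⊤ := SimpleGraph.connected_iff_ediam_ne_top.1 hconn
      refine le_trans ?_ (SimpleGraph.dist_le_diam hfin (u := a 0) (v := a (Fin.last l)))
      obtain ⟨w, hw⟩ := hconn.exists_walk_length_eq_dist (a 0) (a (Fin.last l))
      have := hindex _ _ w 0 (Fin.last l) rfl rfl
      simp at this
      omega

/-! ### Strips that cover almost all pairs -/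

/-- `StripStep t t'` says that in a sequence of triangles `(x, y, z)`, where `{x, y}` is the edge
shared with the predecessor and `z` the opposite vertex, the triangle `t'` can follow `t`. -/
def StripStep {V : Type*} (t t' : V × V × V) : Prop :=
  s(t'.1, t'.2.1) = s(t.2.2, t.1) ∨ s(t'.1, t'.2.1) = s(t.2.2, t.2.1)

/-- The edges of a triangle. -/
def triangleEdges {V : Type*} (t : V × V × V) : List (Sym2 V) :=
  [s(t.1, t.2.1), s(t.2.2, t.1), s(t.2.2, t.2.1)]

/-- If a strip covers all pairs except possibly those in `G`, and has as few triangles as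
possible for that, then its triangles form an induced path. -/
theorem isInducedTrianglePath_of_cover {V : Type*} [Fintype V] [DecidableEq V] (l : ℕ)
    (T : Fin (l + 1) → V × V × V)
    (hT : ∀ k (hk : k + 1 < l + 1), StripStep (T ⟨k, by omega⟩) (T ⟨k + 1, hk⟩))
    (G : Finset (Sym2 V))
    (hcov : ∀ u v, u ≠ v → s(u, v) ∈ G ∨ ∃ k, s(u, v) ∈ triangleEdges (T k))
    (hcard : 2 * (l + 1) + 1 + G.card ≤ (Fintype.card V).choose 2) :
    IsInducedTrianglePath (l + 1) (fun k => {(T k).1, (T k).2.1, (T k).2.2}) := by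
  classical
  -- One label for the base edge of the first triangle and two for the edges at the new vertex of
  -- each triangle: these 2(l + 1) + 1 labels account for every edge of the strip.
  let f : Option (Fin (l + 1) × Bool) → Sym2 V := fun o => match o with
    | none => s((T 0).1, (T 0).2.1)
    | some (k, false) => s((T k).2.2, (T k).1)
    | some (k, true) => s((T k).2.2, (T k).2.1)
  have hprev : ∀ k, ∃ o, f o = s((T k).1, (T k).2.1) ∧
      (o = none ∨ ∃ j b, o = some (j, b) ∧ (j : ℕ) + 1 = k) := by
    rintro ⟨k, hk⟩
    cases k with
    | zero => exact ⟨none, rfl, Or.inl rfl⟩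
    | succ k =>
      rcases hT k hk with h | h
      · exact ⟨some (⟨k, by omega⟩, false), h.symm, Or.inr ⟨_, _, rfl, rfl⟩⟩
      · exact ⟨some (⟨k, by omega⟩, true), h.symm, Or.inr ⟨_, _, rfl, rfl⟩⟩
  let ND : Finset (Sym2 V) := Finset.univ.filter fun e => ¬ e.IsDiag
  have hND : ND.card = (Fintype.card V).choose 2 := by
    rw [← Sym2.card_subtype_not_diag, Fintype.card_subtype]
  have hsub : ND ⊆ Finset.univ.image f ∪ G := by
    intro e
    induction e with | _ u v
    intro he
    have huv : u ≠ v := by simpa [ND] using he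
    rcases hcov u v huv with h | ⟨k, hk⟩
    · exact Finset.mem_union_right _ h
    · refine Finset.mem_union_left _ (Finset.mem_image.2 ?_)
      simp only [triangleEdges, List.mem_cons, List.not_mem_nil, or_false] at hk
      rcases hk with h | h | h
      · obtain ⟨o, ho, -⟩ := hprev k
        exact ⟨o, Finset.mem_univ _, ho.trans h.symm⟩
      · exact ⟨some (k, false), Finset.mem_univ _, h.symm⟩
      · exact ⟨some (k, true), Finset.mem_univ _, h.symm⟩
  have hdom : (Finset.univ : Finset (Option (Fin (l + 1) × Bool))).card = 2 * (l + 1) + 1 := by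
    simp; ring
  have him : (Finset.univ.image f).card ≤ 2 * (l + 1) + 1 :=
    Finset.card_image_le.trans hdom.le
  have hun := Finset.card_union_le (Finset.univ.image f) G
  have hle := Finset.card_le_card hsub
  -- The cardinalities leave no slack: different labels must give different pairs, and none is
  -- degenerate.
  have heq : ND = Finset.univ.image f ∪ G :=
    Finset.eq_of_subset_of_card_le hsub (by omega)
  have hinj : Function.Injective f := by
    have h : (Finset.univ.image f).card =
        (Finset.univ : Finset (Option (Fin (l + 1) × Bool))).card := by omega
    exact Set.injOn_univ.1 (by simpa using Finset.card_image_iff.1 h)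
  have hnd : ∀ o, ¬ (f o).IsDiag := by
    intro o
    have : f o ∈ ND := by
      rw [heq]
      exact Finset.mem_union_left _ (Finset.mem_image_of_mem _ (Finset.mem_univ _))
    simpa [ND] using this
  have hxy : ∀ k, (T k).1 ≠ (T k).2.1 := by
    intro k h
    obtain ⟨o, ho, -⟩ := hprev k
    apply hnd o
    rw [ho, Sym2.mk_isDiag_iff]
    exact h
  have hzx : ∀ k, (T k).2.2 ≠ (T k).1 := fun k h =>
    hnd (some (k, false)) (Sym2.mk_isDiag_iff.2 h)
  have hzy : ∀ k, (T k).2.2 ≠ (T k).2.1 := fun k h =>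
    hnd (some (k, true)) (Sym2.mk_isDiag_iff.2 h)
  set A : Fin (l + 1) → Finset V := fun k => {(T k).1, (T k).2.1, (T k).2.2} with hA
  have hA3 : ∀ k, (A k).card = 3 := fun k =>
    Finset.card_eq_three.2 ⟨_, _, _, hxy k, (hzx k).symm, (hzy k).symm, rfl⟩
  have hedge : ∀ k u v, u ∈ A k → v ∈ A k → u ≠ v → s(u, v) = s((T k).1, (T k).2.1) ∨
      ∃ b, s(u, v) = f (some (k, b)) := by
    intro k u v hu hv huv
    simp only [hA, Finset.mem_insert, Finset.mem_singleton] at hu hv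
    rcases hu with rfl | rfl | rfl <;> rcases hv with rfl | rfl | rfl
    · exact absurd rfl huv
    · exact Or.inl rfl
    · exact Or.inr ⟨false, Sym2.eq_swap⟩
    · exact Or.inl Sym2.eq_swap
    · exact absurd rfl huv
    · exact Or.inr ⟨true, Sym2.eq_swap⟩
    · exact Or.inr ⟨false, rfl⟩
    · exact Or.inr ⟨true, rfl⟩
    · exact absurd rfl huv
  -- Edges of triangle j have labels of index at most j (or `none`); those of triangle k have index
  -- k, except the base, whose index is k - 1. Since labels are injective, only the base of k can be
  -- shared, and only with j = k - 1.
  have hcommon : ∀ j k : Fin (l + 1), j < k → ∀ u v, u ∈ A j → v ∈ A j → u ∈ A k → v ∈ A k →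
      u ≠ v → (j : ℕ) + 1 = k ∧ s(u, v) = s((T k).1, (T k).2.1) := by
    intro j k hjk u v huj hvj huk hvk huv
    have hjk' : (j : ℕ) < k := hjk
    obtain ⟨oj, hoj, hoj'⟩ : ∃ o, s(u, v) = f o ∧
        (o = none ∨ ∃ i b, o = some (i, b) ∧ (i : ℕ) ≤ j) := by
      rcases hedge j u v huj hvj huv with h | ⟨b, h⟩
      · obtain ⟨o, ho, ho'⟩ := hprev j
        refine ⟨o, h.trans ho.symm, ho'.imp_right ?_⟩
        rintro ⟨i, b, h1, h2⟩
        exact ⟨i, b, h1, by omega⟩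
      · exact ⟨_, h, Or.inr ⟨j, b, rfl, le_rfl⟩⟩
    rcases hedge k u v huk hvk huv with h | ⟨b, h⟩
    · refine ⟨?_, h⟩
      obtain ⟨o, ho, ho'⟩ := hprev k
      have hoo : oj = o := hinj (hoj.symm.trans (h.trans ho.symm))
      subst hoo
      rcases hoj' with rfl | ⟨i, b, rfl, hi⟩
      · rcases ho' with h0 | ⟨i, b, h0, -⟩
        -- The base of a triangle other than the first is also a labelled edge of its predecessor,
        -- so its label is not `none`.
        · exfalso
          cases' k with k hk
          cases k with
          | zero => exact absurd hjk' (Nat.not_lt_zero _)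
          | succ k =>
            rcases hT k hk with h' | h'
            · exact Option.some_ne_none _
                (hinj (a₁ := some (⟨k, by omega⟩, false)) (a₂ := none) (h'.symm.trans ho.symm))
            · exact Option.some_ne_none _
                (hinj (a₁ := some (⟨k, by omega⟩, true)) (a₂ := none) (h'.symm.trans ho.symm))
        · exact absurd h0.symm (Option.some_ne_none _)
      · rcases ho' with h0 | ⟨i', b', h0, hi'⟩
        · exact absurd h0 (Option.some_ne_none _)
        · obtain ⟨rfl, rfl⟩ := Prod.mk.inj (Option.some.inj h0)
          omega
    · exfalso
      have hoo := hinj (hoj.symm.trans h)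
      subst hoo
      rcases hoj' with h0 | ⟨i, b', h0, hi⟩
      · exact Option.some_ne_none _ h0
      · obtain ⟨rfl, rfl⟩ := Prod.mk.inj (Option.some.inj h0)
        omega
  have hlt : ∀ j k : Fin (l + 1), j < k → A j ≠ A k ∧
      ((A j ∩ A k).card = 2 ↔ (j : ℕ) + 1 = k) := by
    intro j k hjk
    have hxk : (T k).1 ∈ A k := by simp [hA]
    have hyk : (T k).2.1 ∈ A k := by simp [hA]
    have hzk : (T k).2.2 ∈ A k := by simp [hA]
    -- Otherwise the edge from the new vertex to the first one would be shared with an earlier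
    -- triangle, hence equal to the base.
    have hz : (T k).1 ∈ A j → (T k).2.2 ∉ A j := by
      intro hx hz
      have h := (hcommon j k hjk _ _ hz hx hzk hxk (hzx k)).2
      rw [Sym2.eq_swap, Sym2.congr_right] at h
      exact hzy k h
    refine ⟨fun h => hz (h ▸ hxk) (h ▸ hzk), fun h => ?_, fun h => ?_⟩
    · obtain ⟨u, v, huv, h2⟩ := Finset.card_eq_two.1 h
      have hu : u ∈ A j ∩ A k := by rw [h2]; simp
      have hv : v ∈ A j ∩ A k := by rw [h2]; simp
      rw [Finset.mem_inter] at hu hv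
      exact (hcommon j k hjk u v hu.1 hv.1 hu.2 hv.2 huv).1
    · have hmem : (T k).1 ∈ A j ∧ (T k).2.1 ∈ A j := by
        have hk : k = ⟨(j : ℕ) + 1, by omega⟩ := Fin.ext h.symm
        have := hT j (by omega)
        rw [← hk] at this
        rcases this with h' | h' <;> rcases Sym2.eq_iff.1 h' with ⟨h1, h2⟩ | ⟨h1, h2⟩ <;>
          simp [hA, h1, h2]
      have : A j ∩ A k = {(T k).1, (T k).2.1} := by
        ext u
        simp only [Finset.mem_inter, Finset.mem_insert, Finset.mem_singleton]
        constructor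
        · rintro ⟨hu, hu'⟩
          simp only [hA, Finset.mem_insert, Finset.mem_singleton] at hu'
          rcases hu' with h' | h' | h'
          · exact Or.inl h'
          · exact Or.inr h'
          · exact absurd (h' ▸ hu) (hz hmem.1)
        · rintro (rfl | rfl)
          · exact ⟨hmem.1, hxk⟩
          · exact ⟨hmem.2, hyk⟩
      rw [this, Finset.card_pair (hxy k)]
  refine ⟨hA3, ?_, ?_⟩
  · intro j k hjk
    by_contra hne
    rcases lt_or_gt_of_ne hne with h | h
    · exact (hlt j k h).1 hjk
    · exact (hlt k j h).1 hjk.symm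
  · intro j k
    rcases lt_trichotomy j k with h | rfl | h
    · rw [(hlt j k h).2]
      have : (j : ℕ) < k := h
      omega
    · rw [Finset.inter_self, hA3]
      omega
    · rw [Finset.inter_comm, (hlt k j h).2]
      have : (k : ℕ) < j := h
      omega

theorem mem_simplicialDiameters_of_cover {V : Type*} [Fintype V] [DecidableEq V]
    (L : List (V × V × V)) (hL : L.IsChain StripStep) (G : Finset (Sym2 V)) (hne : L ≠ [])
    (hcov : ∀ u v, u ≠ v → s(u, v) ∈ G ∨ ∃ t ∈ L, s(u, v) ∈ triangleEdges t)
    (hcard : 2 * L.length + 1 + G.card ≤ (Fintype.card V).choose 2) :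
    L.length - 1 ∈ simplicialDiameters (Fintype.card V) 2 := by
  obtain ⟨l, hl⟩ : ∃ l, L.length = l + 1 :=
    ⟨L.length - 1, by have := List.length_pos_of_ne_nil hne; omega⟩
  have h := isInducedTrianglePath_of_cover l (fun k => L[(k : ℕ)]'(by omega))
    (fun k hk => List.isChain_iff_getElem.1 hL k (by omega)) G (fun u v huv => ?_) (by omega)
  · rw [hl]
    exact (h.map (Fintype.equivFin V)).diameter_mem
  · refine (hcov u v huv).imp_right ?_
    rintro ⟨t, ht, htt⟩
    obtain ⟨k, hk, rfl⟩ := List.getElem_of_mem ht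
    exact ⟨⟨k, by omega⟩, htt⟩

/-! ### The upper bound by counting pairs -/

/-- A shortest path realizing the diameter, as a sequence of triangles. -/
theorem exists_triangles_of_mem_simplicialDiameters {n D : ℕ}
    (h : D ∈ simplicialDiameters n 2) :
    ∃ B : ℕ → Finset (Fin n), (∀ k ≤ D, (B k).card = 3) ∧
      (∀ k < D, (B k ∩ B (k + 1)).card = 2) ∧
      ∀ j k, j + 1 < k → k ≤ D → (B j ∩ B k).card ≤ 1 := by
  obtain ⟨K, -, hconn, hD⟩ := h
  have := hconn.nonempty
  obtain ⟨u, v, huv⟩ := (dualGraph 2 K).exists_dist_eq_diam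
  obtain ⟨w, hw⟩ := hconn.exists_walk_length_eq_dist u v
  rw [huv, hD] at hw
  -- Every segment of a shortest path is a shortest path.
  have hdist : ∀ j k, j ≤ k → k ≤ D →
      k ≤ j + (dualGraph 2 K).dist (w.getVert j) (w.getVert k) := by
    intro j k hjk hk
    have h1 : (dualGraph 2 K).dist u (w.getVert j) ≤ j :=
      (SimpleGraph.dist_le (w.take j)).trans (by rw [SimpleGraph.Walk.take_length]; omega)
    have h2 : (dualGraph 2 K).dist (w.getVert k) v ≤ D - k :=
      (SimpleGraph.dist_le (w.drop k)).trans (by rw [SimpleGraph.Walk.drop_length, hw])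
    have h3 := hconn.dist_triangle (u := u) (v := w.getVert j) (w := v)
    have h4 := hconn.dist_triangle (u := w.getVert j) (v := w.getVert k) (w := v)
    omega
  refine ⟨fun k => (w.getVert k).1, fun k _ => (w.getVert k).2.2, fun k hk => ?_,
    fun j k hjk hk => ?_⟩
  · exact w.adj_getVert_succ (by omega)
  -- Two common vertices would mean distance 1 and three would mean equality, but the distance is at
  -- least 2.
  · by_contra hc
    dsimp only at hc
    have hle : ((w.getVert j).1 ∩ (w.getVert k).1).card ≤ 3 :=
      (Finset.card_le_card Finset.inter_subset_left).trans (w.getVert j).2.2.le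
    have hd := hdist j k (by omega) hk
    rcases (by omega : ((w.getVert j).1 ∩ (w.getVert k).1).card = 2 ∨
      ((w.getVert j).1 ∩ (w.getVert k).1).card = 3) with h2 | h3
    · have : (dualGraph 2 K).dist (w.getVert j) (w.getVert k) = 1 :=
        SimpleGraph.dist_eq_one_iff_adj.2 h2
      omega
    · have hjk' : w.getVert j = w.getVert k := by
        apply Subtype.ext
        have h1 := Finset.eq_of_subset_of_card_le (Finset.inter_subset_left
          (s₁ := (w.getVert j).1) (s₂ := (w.getVert k).1)) (by rw [(w.getVert j).2.2, h3])
        have h2 := Finset.eq_of_subset_of_card_le (Finset.inter_subset_right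
          (s₁ := (w.getVert j).1) (s₂ := (w.getVert k).1)) (by rw [(w.getVert k).2.2, h3])
        exact h1.symm.trans h2
      rw [hjk', SimpleGraph.dist_self] at hd
      omega

/-- The pairs that the `k`-th triangle of a sequence adds to its predecessor. -/
def newPairs {n : ℕ} (B : ℕ → Finset (Fin n)) : ℕ → Finset (Finset (Fin n))
  | 0 => (B 0).powersetCard 2
  | k + 1 => (B (k + 1)).powersetCard 2 \ {B k ∩ B (k + 1)}

section NewPairs

variable {n D : ℕ} {B : ℕ → Finset (Fin n)} (h3 : ∀ k ≤ D, (B k).card = 3)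
  (h2 : ∀ k < D, (B k ∩ B (k + 1)).card = 2)
  (h1 : ∀ j k, j + 1 < k → k ≤ D → (B j ∩ B k).card ≤ 1)

theorem newPairs_subset (k : ℕ) : newPairs B k ⊆ (B k).powersetCard 2 := by
  cases k with
  | zero => exact subset_rfl
  | succ k => exact Finset.sdiff_subset

include h3 h2 in
theorem card_newPairs_succ {k : ℕ} (hk : k < D) : (newPairs B (k + 1)).card = 2 := by
  rw [newPairs, Finset.card_sdiff_of_subset, Finset.card_powersetCard, h3 _ hk,
    Finset.card_singleton]
  · rfl
  · rw [Finset.singleton_subset_iff, Finset.mem_powersetCard]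
    exact ⟨Finset.inter_subset_right, h2 k hk⟩

-- Triangles that are not consecutive have no pair in common, and the only pair common to
-- consecutive ones has been removed from the later.
include h2 h1 in
theorem pairwiseDisjoint_newPairs :
    ((Finset.range (D + 1) : Finset ℕ) : Set ℕ).PairwiseDisjoint (newPairs B) := by
  have key : ∀ j k, j < k → k ≤ D → Disjoint (newPairs B j) (newPairs B k) := by
    intro j k hjk hk
    rw [Finset.disjoint_left]
    intro e hj hk'
    have hej := Finset.mem_powersetCard.1 (newPairs_subset j hj)
    have hek := Finset.mem_powersetCard.1 (newPairs_subset k hk')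
    have hsub := Finset.subset_inter hej.1 hek.1
    obtain ⟨k, rfl⟩ : ∃ i, k = i + 1 := ⟨k - 1, by omega⟩
    rcases (by omega : j = k ∨ j + 1 < k + 1) with rfl | hlt
    · rw [newPairs, Finset.mem_sdiff, Finset.mem_singleton] at hk'
      exact hk'.2 (Finset.eq_of_subset_of_card_le hsub (by rw [h2 j hk, hej.2]))
    · have := Finset.card_le_card hsub
      have := h1 j (k + 1) hlt hk
      omega
  intro j hj k hk hjk
  simp only [Finset.coe_range, Set.mem_Iio] at hj hk
  rcases lt_or_gt_of_ne hjk with h | h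
  · exact key j k h (by omega)
  · exact (key k j h (by omega)).symm

include h3 h2 h1 in
theorem card_biUnion_newPairs :
    ((Finset.range (D + 1)).biUnion (newPairs B)).card = 2 * D + 3 := by
  rw [Finset.card_biUnion (pairwiseDisjoint_newPairs h2 h1), Finset.sum_range_succ']
  have h0 : (newPairs B 0).card = 3 := by
    rw [newPairs, Finset.card_powersetCard, h3 0 (Nat.zero_le _)]
    rfl
  rw [h0, Finset.sum_congr rfl fun k hk =>
    card_newPairs_succ h3 h2 (Finset.mem_range.1 hk), Finset.sum_const, Finset.card_range,
    smul_eq_mul, mul_comm]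

theorem biUnion_newPairs_subset :
    (Finset.range (D + 1)).biUnion (newPairs B) ⊆ Finset.univ.powersetCard 2 := by
  intro e he
  obtain ⟨k, -, hk⟩ := Finset.mem_biUnion.1 he
  exact Finset.mem_powersetCard.2
    ⟨Finset.subset_univ _, (Finset.mem_powersetCard.1 (newPairs_subset k hk)).2⟩

end NewPairs

theorem le_of_mem_simplicialDiameters {n D : ℕ} (h : D ∈ simplicialDiameters n 2) :
    2 * D + 3 ≤ n.choose 2 := by
  obtain ⟨B, h3, h2, h1⟩ := exists_triangles_of_mem_simplicialDiameters h
  rw [← card_biUnion_newPairs h3 h2 h1]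
  refine (Finset.card_le_card biUnion_newPairs_subset).trans ?_
  simp

/-! ### The exceptional case n = 6 -/

theorem Finset.card_filter_mem_powersetCard_two {α : Type*} [DecidableEq α] {s : Finset α} {a : α}
    (ha : a ∈ s) : ((s.powersetCard 2).filter (a ∈ ·)).card = s.card - 1 := by
  have : (s.powersetCard 2).filter (a ∈ ·) = (s.erase a).image fun b => {a, b} := by
    ext e
    simp only [mem_filter, mem_powersetCard, mem_image, mem_erase]
    constructor
    · rintro ⟨⟨he, hc⟩, hae⟩
      obtain ⟨b, hb⟩ := card_eq_one.1 (by rw [card_erase_of_mem hae, hc] : (e.erase a).card = 1)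
      have hbe : b ∈ e.erase a := by rw [hb]; exact mem_singleton_self b
      refine ⟨b, ⟨ne_of_mem_erase hbe, he (mem_of_mem_erase hbe)⟩, ?_⟩
      rw [← insert_erase hae, hb]
    · rintro ⟨b, ⟨hba, hb⟩, rfl⟩
      exact ⟨⟨by simp [insert_subset_iff, ha, hb], card_pair hba.symm⟩, by simp⟩
  rw [this, card_image_of_injOn, card_erase_of_mem ha]
  intro b hb c hc hbc
  have hb' : b ∈ ({a, c} : Finset α) := by
    have : b ∈ ({a, b} : Finset α) := by simp
    rwa [show ({a, b} : Finset α) = {a, c} from hbc] at this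
  rcases mem_insert.1 hb' with h | h
  · exact absurd h (ne_of_mem_erase hb)
  · exact mem_singleton.1 h

/-- The sequence records which of the seven triangles contain a given vertex. If A entries are true
and form r runs, the first hypothesis says A + r = 5, so (A, r) is (4, 1) or (3, 2). In the first
case there are three consecutive true pairs. In the second, one run has length 1; the second
hypothesis puts it at an end, where it contributes 2, and the other run contributes 1. -/
theorem three_le_of_boolean_sequence : ∀ b : Fin 7 → Bool,
    (2 * ∑ k, (b k).toNat = 5 + ∑ k : Fin 6, (b k.castSucc && b k.succ).toNat) →
    (∀ k : Fin 5, b k.succ.castSucc → b k.castSucc.castSucc ∨ b k.succ.succ) →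
    3 ≤ (∑ k : Fin 6, (b k.castSucc && b k.succ).toNat) + 2 * (b 0 && !b 1).toNat +
      2 * (b 6 && !b 5).toNat := by
  decide +kernel

/-- The inequality for boolean sequences, summed over the six vertices, would read 18 ≤ 6 · 2 + 2 +
2. -/
theorem six_notMem_simplicialDiameters_six : 6 ∉ simplicialDiameters 6 2 := by
  intro h
  obtain ⟨B, h3, h2, h1⟩ := exists_triangles_of_mem_simplicialDiameters h
  have hall : (Finset.range 7).biUnion (newPairs B) = Finset.univ.powersetCard 2 :=
    Finset.eq_of_subset_of_card_le (biUnion_newPairs_subset (D := 6))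
      (by rw [card_biUnion_newPairs h3 h2 h1]; rfl)
  let b : Fin 6 → Fin 7 → Bool := fun v k => decide (v ∈ B k)
  -- All 15 pairs occur once, five of them at `v`. Each triangle at `v` brings two of these, less
  -- one if `v` lies on the edge shared with the preceding triangle.
  have hdeg : ∀ v, 2 * ∑ k, (b v k).toNat =
      5 + ∑ k : Fin 6, (b v k.castSucc && b v k.succ).toNat := by
    intro v
    have hpairs : ∀ k ≤ 6, (((B k).powersetCard 2).filter (v ∈ ·)).card =
        2 * (decide (v ∈ B k)).toNat := by
      intro k hk
      by_cases hv : v ∈ B k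
      · rw [Finset.card_filter_mem_powersetCard_two hv, h3 k hk]
        simp [hv]
      · rw [Finset.card_eq_zero.2]
        · simp [hv]
        · refine Finset.filter_eq_empty_iff.2 fun e he hve => hv ?_
          exact (Finset.mem_powersetCard.1 he).1 hve
    have hnew : ∀ k < 6, ((newPairs B (k + 1)).filter (v ∈ ·)).card +
        (decide (v ∈ B k) && decide (v ∈ B (k + 1))).toNat =
        2 * (decide (v ∈ B (k + 1))).toNat := by
      intro k hk
      rw [← hpairs (k + 1) hk]
      have hmem : B k ∩ B (k + 1) ∈ (B (k + 1)).powersetCard 2 :=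
        Finset.mem_powersetCard.2 ⟨Finset.inter_subset_right, h2 k hk⟩
      have hfilter : (newPairs B (k + 1)).filter (v ∈ ·) =
          ((B (k + 1)).powersetCard 2).filter (v ∈ ·) \
            ({B k ∩ B (k + 1)} : Finset (Finset (Fin 6))).filter (v ∈ ·) := by
        rw [newPairs]
        ext e
        simp only [Finset.mem_filter, Finset.mem_sdiff]
        tauto
      have hsub : ({B k ∩ B (k + 1)} : Finset (Finset (Fin 6))).filter (v ∈ ·) ⊆
          ((B (k + 1)).powersetCard 2).filter (v ∈ ·) :=
        Finset.filter_subset_filter _ (Finset.singleton_subset_iff.2 hmem)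
      have hone : (({B k ∩ B (k + 1)} : Finset (Finset (Fin 6))).filter (v ∈ ·)).card =
          (decide (v ∈ B k) && decide (v ∈ B (k + 1))).toNat := by
        rw [Finset.filter_singleton]
        by_cases hv : v ∈ B k ∩ B (k + 1)
        · rw [if_pos hv]
          rw [Finset.mem_inter] at hv
          simp [hv]
        · rw [if_neg hv]
          rw [Finset.mem_inter, ← Bool.decide_and] at *
          simp [hv]
      rw [hfilter, Finset.card_sdiff_of_subset hsub, ← hone]
      exact Nat.sub_add_cancel (Finset.card_le_card hsub)
    have htot : ∑ k ∈ Finset.range 7, ((newPairs B k).filter (v ∈ ·)).card = 5 := by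
      rw [← Finset.card_biUnion, ← Finset.filter_biUnion, hall,
        Finset.card_filter_mem_powersetCard_two (Finset.mem_univ v)]
      · rfl
      · exact fun j hj k hk hjk => Finset.disjoint_filter_filter
          (pairwiseDisjoint_newPairs h2 h1 hj hk hjk)
    have h0 := hpairs 0 (by norm_num)
    have e0 := hnew 0 (by norm_num)
    have e1 := hnew 1 (by norm_num)
    have e2 := hnew 2 (by norm_num)
    have e3 := hnew 3 (by norm_num)
    have e4 := hnew 4 (by norm_num)
    have e5 := hnew 5 (by norm_num)
    simp only [Finset.sum_range_succ, Finset.sum_range_zero] at htot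
    have hz : newPairs B 0 = (B 0).powersetCard 2 := rfl
    rw [hz] at htot
    simp only [Fin.sum_univ_succ, Fin.sum_univ_zero, b]
    norm_num [Fin.succ, Fin.castSucc] at *
    omega
  -- If neither neighbour of a triangle at `v` contained `v`, both would share with it the edge
  -- opposite `v`, and hence share that edge with each other.
  have hiso : ∀ v, ∀ k : Fin 5, b v k.succ.castSucc →
      b v k.castSucc.castSucc ∨ b v k.succ.succ := by
    intro v k hk
    by_contra hc
    simp only [b, decide_eq_true_eq, Fin.val_castSucc, Fin.val_succ, not_or] at hk hc
    have hcard : ((B (k + 1)).erase v).card = 2 := by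
      rw [Finset.card_erase_of_mem hk, h3 _ (by omega)]
    have hl : B k ∩ B (k + 1) ⊆ (B (k + 1)).erase v := fun u hu => by
      rw [Finset.mem_inter] at hu
      exact Finset.mem_erase.2 ⟨fun huv => hc.1 (huv ▸ hu.1), hu.2⟩
    have hr : B (k + 1) ∩ B (k + 1 + 1) ⊆ (B (k + 1)).erase v := fun u hu => by
      rw [Finset.mem_inter] at hu
      exact Finset.mem_erase.2 ⟨fun huv => hc.2 (huv ▸ hu.2), hu.1⟩
    have hl' := Finset.eq_of_subset_of_card_le hl (by rw [hcard, h2 _ (by omega)])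
    have hr' := Finset.eq_of_subset_of_card_le hr (by rw [hcard, h2 _ (by omega)])
    have hsub : (B (k + 1)).erase v ⊆ B k ∩ B (k + 1 + 1) := Finset.subset_inter
      (hl' ▸ Finset.inter_subset_left) (hr' ▸ Finset.inter_subset_right)
    have h4 := Finset.card_le_card hsub
    have h5 := h1 k (k + 1 + 1) (by omega) (by omega)
    omega
  have hthree := fun v => three_le_of_boolean_sequence (b v) (hdeg v) (hiso v)
  have hcount : ∀ S : Finset (Fin 6), ∑ v, (decide (v ∈ S)).toNat = S.card := by
    intro S
    simp [Bool.toNat, Bool.cond_decide]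
  have hsum := Finset.sum_le_sum fun v (_ : v ∈ Finset.univ) => hthree v
  rw [Finset.sum_add_distrib, Finset.sum_add_distrib, Finset.sum_comm, ← Finset.mul_sum,
    ← Finset.mul_sum] at hsum
  have hconsec : ∀ k : Fin 6, ∑ v, (b v k.castSucc && b v k.succ).toNat = 2 := by
    intro k
    rw [← h2 k k.2, ← hcount]
    refine Finset.sum_congr rfl fun v _ => ?_
    simp [b, Finset.mem_inter]
  have hdiff : ∀ S T : Finset (Fin 6), S.card = 3 → (S ∩ T).card = 2 →
      ∑ v, (decide (v ∈ S) && !decide (v ∈ T)).toNat = 1 := by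
    intro S T hS hST
    have : (S \ T).card = 1 := by
      rw [Finset.card_sdiff, Finset.inter_comm, hS, hST]
    rw [← this, ← hcount]
    refine Finset.sum_congr rfl fun v _ => ?_
    simp [Finset.mem_sdiff]
  have hfirst : ∑ v, (b v 0 && !b v 1).toNat = 1 :=
    hdiff (B 0) (B 1) (h3 0 (by norm_num)) (h2 0 (by norm_num))
  have hlast : ∑ v, (b v 6 && !b v 5).toNat = 1 :=
    hdiff (B 6) (B 5) (h3 6 le_rfl) (by rw [Finset.inter_comm]; exact h2 5 (by norm_num))
  rw [Finset.sum_congr rfl fun k _ => hconsec k, hfirst, hlast] at hsum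
  simp at hsum

/-! ### Explicit strips for small n -/

/-- The vertices of a triangle. -/
def triangleVertices {V : Type*} (t : V × V × V) : List V := [t.1, t.2.1, t.2.2]

theorem mem_triangleEdges_of_mem {V : Type*} {t : V × V × V} {u v : V} (huv : u ≠ v)
    (hu : u ∈ triangleVertices t) (hv : v ∈ triangleVertices t) :
    s(u, v) ∈ triangleEdges t := by
  simp only [triangleVertices, triangleEdges, List.mem_cons, List.not_mem_nil, or_false] at *
  rcases hu with rfl | rfl | rfl <;> rcases hv with rfl | rfl | rfl <;> simp_all [Sym2.eq_swap]

/-- The kernel-friendly test whether an explicit list is a strip covering all pairs outside `G`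
with as few triangles as possible. -/
def stripCheck (n : ℕ) (G : List (Fin n × Fin n)) (L : List (Fin n × Fin n × Fin n)) : Bool :=
  L ≠ [] ∧ 2 * L.length + 1 + G.length ≤ n.choose 2 ∧
    L.IsChain (fun t t' =>
      (t'.1 = t.2.2 ∧ (t'.2.1 = t.1 ∨ t'.2.1 = t.2.1)) ∨
        (t'.2.1 = t.2.2 ∧ (t'.1 = t.1 ∨ t'.1 = t.2.1))) ∧
    ∀ u v : Fin n, u < v → (u, v) ∈ G ∨
      ∃ t ∈ L, (u = t.1 ∨ u = t.2.1 ∨ u = t.2.2) ∧ (v = t.1 ∨ v = t.2.1 ∨ v = t.2.2)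

theorem mem_simplicialDiameters_of_check (n : ℕ) (G : List (Fin n × Fin n))
    (L : List (Fin n × Fin n × Fin n)) (h : stripCheck n G L) :
    L.length - 1 ∈ simplicialDiameters n 2 := by
  simp only [stripCheck, decide_eq_true_eq] at h
  obtain ⟨hne, hcard, hchain, hcov⟩ := h
  have hG : (G.map fun e => s(e.1, e.2)).toFinset.card ≤ G.length :=
    (List.toFinset_card_le _).trans (by simp)
  have hlt : ∀ u v : Fin n, u < v → s(u, v) ∈ (G.map fun e => s(e.1, e.2)).toFinset ∨
      ∃ t ∈ L, s(u, v) ∈ triangleEdges t := by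
    intro u v huv
    refine (hcov u v huv).imp (fun h => ?_) ?_
    · exact List.mem_toFinset.2 (List.mem_map.2 ⟨_, h, rfl⟩)
    · rintro ⟨t, ht, hu, hv⟩
      exact ⟨t, ht, mem_triangleEdges_of_mem huv.ne (by simpa [triangleVertices] using hu)
        (by simpa [triangleVertices] using hv)⟩
  have := mem_simplicialDiameters_of_cover L (hchain.imp fun t t' h => ?_)
    (G.map fun e => s(e.1, e.2)).toFinset hne (fun u v huv => ?_)
    (by rw [Fintype.card_fin]; omega)
  · rwa [Fintype.card_fin] at this
  · simp only [StripStep, Sym2.eq_iff]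
    tauto
  · rcases lt_or_gt_of_ne huv with h | h
    · exact hlt u v h
    · rw [Sym2.eq_swap]
      exact hlt v u h

theorem diameter_mem_3 : 0 ∈ simplicialDiameters 3 2 :=
  mem_simplicialDiameters_of_check 3 []
    [(0, 1, 2)]
    (by decide +kernel)

theorem diameter_mem_4 : 1 ∈ simplicialDiameters 4 2 :=
  mem_simplicialDiameters_of_check 4 [(2, 3)]
    [(1, 2, 0), (0, 1, 3)]
    (by decide +kernel)

theorem diameter_mem_5 : 3 ∈ simplicialDiameters 5 2 :=
  mem_simplicialDiameters_of_check 5 [(1, 4)]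
    [(1, 2, 0), (0, 1, 3), (0, 3, 4), (3, 4, 2)]
    (by decide +kernel)

/-- Two pairs stay uncovered: the strip has one triangle fewer than the count of pairs alone would
permit. -/
theorem diameter_mem_6 : 5 ∈ simplicialDiameters 6 2 :=
  mem_simplicialDiameters_of_check 6 [(2, 3), (3, 5)]
    [(5, 1, 4), (4, 5, 2), (2, 5, 0), (0, 2, 1), (0, 1, 3), (0, 3, 4)]
    (by decide +kernel)

theorem diameter_mem_7 : 9 ∈ simplicialDiameters 7 2 :=
  mem_simplicialDiameters_of_check 7 []
    [(1, 5, 2), (2, 5, 6), (2, 6, 0), (0, 6, 4), (4, 6, 1), (1, 6, 3), (1, 3, 0), (0, 3, 5),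
      (3, 5, 4), (3, 4, 2)]
    (by decide +kernel)

theorem diameter_mem_8 : 12 ∈ simplicialDiameters 8 2 :=
  mem_simplicialDiameters_of_check 8 [(0, 7)]
    [(3, 2, 0), (0, 3, 5), (3, 5, 4), (4, 5, 6), (4, 6, 7), (6, 7, 2), (2, 7, 5), (5, 7, 1),
      (1, 7, 3), (1, 3, 6), (1, 6, 0), (0, 1, 4), (1, 4, 2)]
    (by decide +kernel)

theorem diameter_mem_9 : 16 ∈ simplicialDiameters 9 2 :=
  mem_simplicialDiameters_of_check 9 [(2, 7)]
    [(4, 6, 0), (0, 6, 3), (3, 6, 7), (3, 7, 1), (1, 7, 4), (1, 4, 2), (1, 2, 0), (0, 1, 5),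
      (1, 5, 6), (1, 6, 8), (6, 8, 2), (2, 8, 3), (2, 3, 5), (3, 5, 4), (4, 5, 8), (5, 8, 7),
      (7, 8, 0)]
    (by decide +kernel)

theorem diameter_mem_10 : 21 ∈ simplicialDiameters 10 2 :=
  mem_simplicialDiameters_of_check 10 []
    [(5, 7, 0), (0, 5, 1), (0, 1, 9), (0, 9, 3), (0, 3, 2), (2, 3, 7), (2, 7, 8), (7, 8, 1),
      (1, 8, 4), (4, 8, 0), (0, 4, 6), (4, 6, 3), (3, 6, 1), (1, 6, 2), (2, 6, 5), (2, 5, 4),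
      (2, 4, 9), (4, 9, 7), (7, 9, 6), (6, 9, 8), (8, 9, 5), (5, 8, 3)]
    (by decide +kernel)

theorem diameter_mem_11 : 26 ∈ simplicialDiameters 11 2 :=
  mem_simplicialDiameters_of_check 11 []
    [(3, 8, 4), (4, 8, 2), (2, 8, 7), (2, 7, 10), (7, 10, 5), (5, 7, 6), (6, 7, 1), (1, 6,
      8), (1, 8, 10), (1, 10, 4), (1, 4, 5), (1, 5, 2), (2, 5, 9), (5, 9, 8), (5, 8, 0), (0,
      5, 3), (0, 3, 1), (0, 1, 9), (0, 9, 10), (9, 10, 6), (6, 10, 3), (3, 6, 2), (2, 6, 0),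
      (0, 6, 4), (0, 4, 7), (4, 7, 9), (7, 9, 3)]
    (by decide +kernel)

theorem diameter_mem_12 : 31 ∈ simplicialDiameters 12 2 :=
  mem_simplicialDiameters_of_check 12 [(2, 3)]
    [(2, 8, 6), (6, 8, 7), (7, 8, 0), (0, 8, 11), (8, 11, 3), (3, 11, 7), (7, 11, 10), (7,
      10, 5), (5, 10, 2), (2, 5, 0), (0, 2, 1), (0, 1, 3), (0, 3, 10), (3, 10, 9), (3, 9, 4),
      (3, 4, 5), (3, 5, 6), (5, 6, 1), (1, 6, 11), (1, 11, 4), (1, 4, 7), (4, 7, 2), (2, 7,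
      9), (2, 9, 11), (9, 11, 5), (5, 9, 8), (8, 9, 1), (1, 8, 10), (8, 10, 4), (4, 10, 6),
      (4, 6, 0), (0, 6, 9)]
    (by decide +kernel)

theorem diameter_mem_14 : 44 ∈ simplicialDiameters 14 2 :=
  mem_simplicialDiameters_of_check 14 []
    [(13, 5, 3), (3, 5, 2), (2, 5, 0), (0, 2, 6), (0, 6, 4), (0, 4, 1), (1, 4, 7), (4, 7,
      12), (4, 12, 13), (12, 13, 1), (1, 12, 3), (3, 12, 6), (3, 6, 11), (6, 11, 9), (9, 11,
      7), (7, 11, 5), (5, 11, 4), (4, 5, 10), (4, 10, 9), (9, 10, 12), (10, 12, 8), (8, 12,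
      5), (5, 8, 9), (5, 9, 1), (1, 5, 6), (1, 6, 8), (6, 8, 13), (6, 13, 7), (6, 7, 10), (7,
      10, 3), (3, 10, 0), (0, 3, 9), (0, 9, 13), (9, 13, 2), (2, 13, 10), (10, 13, 11), (10,
      11, 1), (1, 11, 2), (2, 11, 12), (11, 12, 0), (0, 11, 8), (0, 8, 7), (7, 8, 2), (2, 8,
      4), (4, 8, 3)]
    (by decide +kernel)

theorem diameter_mem_15 : 51 ∈ simplicialDiameters 15 2 :=
  mem_simplicialDiameters_of_check 15 []
    [(13, 0, 1), (1, 13, 11), (11, 13, 7), (7, 11, 5), (5, 11, 12), (11, 12, 2), (2, 11, 14),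
      (11, 14, 4), (4, 14, 8), (8, 14, 6), (6, 14, 13), (6, 13, 2), (2, 6, 5), (2, 5, 4), (2,
      4, 9), (4, 9, 13), (4, 13, 12), (12, 13, 3), (3, 13, 5), (5, 13, 10), (10, 13, 8), (8,
      10, 7), (7, 8, 12), (7, 12, 6), (6, 7, 4), (4, 7, 0), (0, 7, 2), (0, 2, 8), (0, 8, 11),
      (8, 11, 3), (3, 8, 9), (8, 9, 5), (5, 8, 1), (1, 5, 14), (5, 14, 0), (0, 14, 12), (0,
      12, 9), (9, 12, 10), (10, 12, 1), (1, 10, 4), (1, 4, 3), (1, 3, 2), (2, 3, 10), (3, 10,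
      14), (3, 14, 7), (7, 14, 9), (7, 9, 1), (1, 9, 6), (6, 9, 11), (6, 11, 10), (6, 10, 0),
      (0, 6, 3)]
    (by decide +kernel)

theorem diameter_mem_18 : 75 ∈ simplicialDiameters 18 2 :=
  mem_simplicialDiameters_of_check 18 []
    [(14, 16, 13), (13, 14, 8), (8, 13, 5), (5, 8, 15), (5, 15, 4), (4, 15, 3), (3, 15, 11),
      (11, 15, 10), (10, 11, 14), (10, 14, 6), (6, 14, 0), (0, 6, 11), (6, 11, 9), (6, 9, 15),
      (9, 15, 13), (13, 15, 2), (2, 15, 0), (0, 15, 16), (15, 16, 17), (16, 17, 10), (10, 16,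
      8), (8, 16, 6), (6, 16, 4), (4, 6, 17), (6, 17, 5), (5, 17, 2), (2, 5, 11), (2, 11, 16),
      (11, 16, 1), (1, 11, 8), (8, 11, 12), (8, 12, 9), (8, 9, 17), (9, 17, 7), (7, 17, 11),
      (7, 11, 13), (11, 13, 4), (4, 13, 1), (1, 4, 2), (1, 2, 9), (2, 9, 14), (9, 14, 4), (4,
      9, 0), (0, 4, 8), (0, 8, 3), (0, 3, 1), (0, 1, 17), (0, 17, 13), (0, 13, 12), (12, 13,
      6), (6, 13, 3), (3, 13, 10), (3, 10, 2), (2, 10, 12), (10, 12, 1), (1, 10, 5), (5, 10,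
      9), (5, 9, 16), (9, 16, 3), (3, 16, 7), (7, 16, 12), (7, 12, 4), (4, 7, 10), (7, 10, 0),
      (0, 7, 5), (5, 7, 14), (5, 14, 3), (3, 5, 12), (3, 12, 17), (12, 17, 14), (12, 14, 15),
      (14, 15, 1), (1, 15, 7), (1, 7, 6), (6, 7, 2), (2, 7, 8)]
    (by decide +kernel)

theorem diameter_mem_22 : 114 ∈ simplicialDiameters 22 2 :=
  mem_simplicialDiameters_of_check 22 []
    [(17, 4, 11), (11, 17, 3), (3, 17, 6), (6, 17, 2), (2, 17, 16), (2, 16, 3), (2, 3, 14),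
      (3, 14, 5), (3, 5, 4), (4, 5, 21), (4, 21, 10), (4, 10, 19), (4, 19, 13), (4, 13, 20),
      (4, 20, 15), (15, 20, 18), (15, 18, 6), (6, 15, 19), (6, 19, 8), (8, 19, 21), (8, 21,
      18), (18, 21, 2), (2, 18, 4), (4, 18, 16), (4, 16, 8), (8, 16, 7), (7, 16, 1), (1, 7,
      19), (7, 19, 3), (3, 7, 20), (7, 20, 0), (0, 20, 2), (0, 2, 1), (0, 1, 4), (0, 4, 9),
      (0, 9, 16), (0, 16, 13), (0, 13, 5), (5, 13, 7), (7, 13, 18), (13, 18, 9), (9, 13, 17),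
      (9, 17, 8), (8, 17, 12), (8, 12, 5), (5, 12, 11), (5, 11, 20), (5, 20, 16), (5, 16, 6),
      (5, 6, 1), (1, 6, 13), (1, 13, 8), (8, 13, 2), (2, 8, 15), (2, 15, 5), (2, 5, 9), (5, 9,
      10), (9, 10, 6), (6, 9, 11), (6, 11, 21), (6, 21, 0), (0, 21, 15), (15, 21, 16), (15,
      16, 12), (12, 15, 7), (7, 12, 21), (12, 21, 13), (13, 21, 14), (14, 21, 17), (14, 17,
      18), (17, 18, 1), (1, 17, 15), (1, 15, 11), (11, 15, 13), (13, 15, 10), (10, 13, 3), (3,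
      10, 18), (10, 18, 12), (10, 12, 0), (0, 10, 17), (10, 17, 7), (7, 10, 2), (2, 7, 11),
      (2, 11, 19), (2, 19, 12), (12, 19, 14), (14, 19, 16), (14, 16, 10), (10, 16, 11), (10,
      11, 8), (8, 10, 20), (10, 20, 1), (1, 20, 14), (14, 20, 6), (6, 20, 12), (6, 12, 4), (4,
      6, 7), (4, 7, 14), (7, 14, 9), (9, 14, 15), (9, 15, 3), (3, 9, 12), (3, 12, 1), (1, 3,
      21), (1, 21, 9), (9, 21, 20), (9, 20, 19), (19, 20, 17), (17, 19, 5), (5, 19, 18), (18,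
      19, 0), (0, 18, 11), (0, 11, 14), (0, 14, 8), (0, 8, 3)]
    (by decide +kernel)

theorem diameter_mem_26 : 161 ∈ simplicialDiameters 26 2 :=
  mem_simplicialDiameters_of_check 26 []
    [(16, 5, 1), (1, 5, 9), (5, 9, 15), (5, 15, 3), (3, 15, 10), (10, 15, 22), (15, 22, 2),
      (2, 22, 4), (2, 4, 8), (2, 8, 14), (8, 14, 18), (8, 18, 7), (7, 18, 10), (7, 10, 16),
      (7, 16, 4), (4, 16, 20), (16, 20, 0), (0, 16, 18), (16, 18, 9), (9, 18, 23), (18, 23,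
      4), (4, 23, 21), (4, 21, 25), (21, 25, 17), (17, 25, 22), (17, 22, 0), (0, 22, 7), (0,
      7, 1), (1, 7, 12), (1, 12, 10), (1, 10, 20), (10, 20, 9), (9, 10, 13), (9, 13, 14), (9,
      14, 0), (0, 14, 21), (14, 21, 10), (10, 14, 6), (6, 14, 5), (5, 14, 17), (14, 17, 20),
      (14, 20, 12), (12, 20, 13), (12, 13, 24), (12, 24, 8), (8, 24, 21), (8, 21, 5), (5, 21,
      12), (12, 21, 6), (6, 12, 4), (4, 6, 0), (0, 4, 19), (0, 19, 8), (0, 8, 15), (8, 15,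
      20), (15, 20, 21), (15, 21, 16), (15, 16, 13), (13, 16, 22), (13, 22, 5), (5, 13, 4),
      (4, 5, 10), (5, 10, 11), (5, 11, 0), (0, 11, 3), (3, 11, 20), (11, 20, 7), (7, 11, 15),
      (11, 15, 14), (11, 14, 4), (4, 11, 17), (11, 17, 24), (17, 24, 16), (16, 24, 14), (14,
      24, 19), (19, 24, 7), (7, 19, 5), (5, 19, 2), (2, 19, 10), (2, 10, 24), (10, 24, 0), (0,
      10, 25), (0, 25, 12), (12, 25, 2), (2, 12, 18), (12, 18, 17), (17, 18, 6), (6, 18, 15),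
      (6, 15, 19), (15, 19, 12), (12, 19, 23), (19, 23, 16), (16, 23, 2), (2, 23, 0), (0, 23,
      13), (13, 23, 11), (11, 13, 19), (11, 19, 22), (11, 22, 6), (6, 22, 24), (6, 24, 1), (1,
      24, 23), (1, 23, 3), (1, 3, 4), (1, 4, 15), (4, 15, 24), (4, 24, 9), (9, 24, 3), (3, 24,
      25), (3, 25, 14), (3, 14, 7), (3, 7, 6), (6, 7, 9), (7, 9, 17), (9, 17, 2), (2, 17, 3),
      (3, 17, 8), (3, 8, 13), (3, 13, 18), (3, 18, 21), (3, 21, 19), (19, 21, 9), (9, 21, 22),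
      (9, 22, 12), (12, 22, 3), (3, 12, 16), (12, 16, 11), (11, 16, 8), (8, 11, 1), (1, 11,
      21), (11, 21, 2), (2, 21, 7), (7, 21, 13), (7, 13, 25), (7, 25, 23), (23, 25, 15), (15,
      23, 17), (17, 23, 10), (10, 23, 8), (8, 23, 22), (22, 23, 14), (14, 22, 1), (1, 22, 18),
      (18, 22, 20), (18, 20, 19), (19, 20, 25), (19, 25, 1), (1, 19, 17), (1, 17, 13), (1, 13,
      2), (2, 13, 6), (2, 6, 20), (6, 20, 23), (20, 23, 5), (5, 20, 24), (5, 24, 18), (5, 18,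
      25), (18, 25, 11), (11, 25, 9), (9, 25, 8), (8, 25, 6), (6, 25, 16)]
    (by decide +kernel)

/-! ### Fans over paths with constant difference -/

theorem List.isChain_map_range {α : Type*} {R : α → α → Prop} (f : ℕ → α) (n : ℕ)
    (h : ∀ i, i + 1 < n → R (f i) (f (i + 1))) : ((List.range n).map f).IsChain R := by
  rw [List.isChain_iff_getElem]
  intro i hi
  simp only [List.length_map, List.length_range] at hi
  simpa using h i hi

theorem List.getLast?_map_range_succ {α : Type*} (f : ℕ → α) (n : ℕ) :
    ((List.range (n + 1)).map f).getLast? = some (f n) := by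
  simp [List.range_succ]

theorem List.head?_map_range_succ {α : Type*} (f : ℕ → α) (n : ℕ) :
    ((List.range (n + 1)).map f).head? = some (f 0) := by
  simp [List.range_succ_eq_map]

/-- The steps of size `d` thus form a Hamilton cycle, along which the fans run. -/
theorem ZMod.exists_eq_mul_natCast {m : ℕ} [NeZero m] {d : ZMod m} (hd : IsUnit d)
    (u : ZMod m) : ∃ i < m, u = d * (i : ZMod m) := by
  obtain ⟨e, rfl⟩ := hd
  refine ⟨(e⁻¹ * u).val, ZMod.val_lt _, ?_⟩
  rw [ZMod.natCast_zmod_val, Units.mul_inv_cancel_left]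

/-- Two vertices are covered by a list of triangles if one of these contains both. -/
def Covers {V : Type*} (L : List (V × V × V)) (u v : V) : Prop :=
  ∃ t ∈ L, u ∈ triangleVertices t ∧ v ∈ triangleVertices t

theorem Covers.symm {V : Type*} {L : List (V × V × V)} {u v : V} (h : Covers L u v) :
    Covers L v u :=
  let ⟨t, ht, hu, hv⟩ := h
  ⟨t, ht, hv, hu⟩

theorem Covers.mono {V : Type*} {L L' : List (V × V × V)} {u v : V} (h : Covers L u v)
    (hL : L ⊆ L') : Covers L' u v :=
  let ⟨t, ht, hu, hv⟩ := h
  ⟨t, hL ht, hu, hv⟩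

/-- The fan with apex `I` over the path `b, b + d, …, b + n * d`. -/
def fan {V : Type*} {m : ℕ} (ι : ZMod m → V) (I : V) (b d : ZMod m) (n : ℕ) :
    List (V × V × V) :=
  (List.range n).map fun i : ℕ => (I, ι (b + d * (i : ZMod m)), ι (b + d * ((i + 1 : ℕ) : ZMod m)))

section Fan

variable {V : Type*} {m : ℕ} (ι : ZMod m → V) (I : V) (b d : ZMod m) (n : ℕ)

theorem isChain_fan : (fan ι I b d n).IsChain StripStep :=
  List.isChain_map_range (R := StripStep) _ _ fun _ _ => Or.inl Sym2.eq_swap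

theorem length_fan : (fan ι I b d n).length = n := by simp [fan]

theorem head?_fan_succ : (fan ι I b d (n + 1)).head? = some (I, ι b, ι (b + d)) := by
  rw [fan, List.head?_map_range_succ]
  simp

theorem getLast?_fan_succ : (fan ι I b d (n + 1)).getLast? =
    some (I, ι (b + d * (n : ZMod m)), ι (b + d * ((n + 1 : ℕ) : ZMod m))) :=
  List.getLast?_map_range_succ _ _

variable {n}

theorem covers_fan_edge {i : ℕ} (hi : i < n) :
    Covers (fan ι I b d n) (ι (b + d * (i : ZMod m))) (ι (b + d * (i : ZMod m) + d)) := by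
  refine ⟨_, List.mem_map.2 ⟨i, List.mem_range.2 hi, rfl⟩, ?_, ?_⟩
  · simp [triangleVertices]
  · have : b + d * (i : ZMod m) + d = b + d * ((i + 1 : ℕ) : ZMod m) := by push_cast; ring
    simp [triangleVertices, this]

theorem covers_fan_apex {i : ℕ} (hn : 0 < n) (hi : i ≤ n) :
    Covers (fan ι I b d n) I (ι (b + d * (i : ZMod m))) := by
  rcases hi.lt_or_eq with h | rfl
  · exact ⟨_, List.mem_map.2 ⟨i, List.mem_range.2 h, rfl⟩, by simp [triangleVertices],
      by simp [triangleVertices]⟩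
  · refine ⟨_, List.mem_map.2 ⟨i - 1, List.mem_range.2 (by omega), rfl⟩,
      by simp [triangleVertices], ?_⟩
    rw [Nat.sub_add_cancel hn]
    simp [triangleVertices]

end Fan

/-! ### Strips invariant under translation -/

/-- The `i`-th triangle at the hub `c` of a strip that is periodic under the translation by `s`. -/
def wheelTriangle {V : Type*} {m : ℕ} (ι : ZMod m → V) (p : ℕ) (x : ℕ → ZMod m) (s c : ZMod m)
    (i : ℕ) : V × V × V :=
  if i + 1 < p then (ι c, ι (c + x i), ι (c + x (i + 1))) else (ι c, ι (c + x i), ι (c + s))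

/-- The `k`-th triangle of a strip that is periodic under the translation by `s`. -/
def wheelSeq {V : Type*} {m : ℕ} (ι : ZMod m → V) (p : ℕ) (x : ℕ → ZMod m) (s : ZMod m)
    (k : ℕ) : V × V × V :=
  wheelTriangle ι p x s (s * ((k / p : ℕ) : ZMod m)) (k % p)

/-- The closed strip of all triangles of `wheelSeq` without the one with index `a`. -/
def wheelStrip {V : Type*} {m : ℕ} (ι : ZMod m → V) (p : ℕ) (x : ℕ → ZMod m) (s : ZMod m)
    (a : ℕ) : List (V × V × V) :=
  (List.range (m * p - 1)).map fun k => wheelSeq ι p x s (a + 1 + k)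

/-- Up to sign, the nonzero elements of `ZMod m` are `x 0, …, x (p - 1)`, the consecutive
differences, the difference `s` between the last and the first term, and the elements of `D`. -/
structure IsWheel {m : ℕ} (p : ℕ) (x : ℕ → ZMod m) (s : ZMod m) (D : List (ZMod m)) : Prop where
  isUnit : IsUnit s
  closing : s + x 0 = x (p - 1)
  cover : ∀ d ≠ 0, (∃ i < p, d = x i ∨ d = -x i) ∨
    (∃ i, i + 1 < p ∧ (d = x (i + 1) - x i ∨ d = -(x (i + 1) - x i))) ∨ (d = s ∨ d = -s) ∨
    ∃ e ∈ D, d = e ∨ d = -e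

section Wheel

variable {V : Type*} {m : ℕ} (ι : ZMod m → V) {p : ℕ} {x : ℕ → ZMod m} {s : ZMod m}
  {D : List (ZMod m)}

/-- Consecutive triangles at one hub share a spoke. At a passage the newest vertex c + s becomes the
hub, and the closing condition makes its spoke of index 0 end at c + x (p - 1), so that this spoke
is an edge of the last triangle at c. -/
theorem wheelSeq_step (hp : 0 < p) (hc : s + x 0 = x (p - 1)) (k : ℕ) :
    StripStep (wheelSeq ι p x s k) (wheelSeq ι p x s (k + 1)) := by
  have hk := Nat.mod_lt k hp
  by_cases h : k % p + 1 < p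
  · have h0 : k + 1 = (k % p + 1) + p * (k / p) := by
      have := Nat.div_add_mod k p
      omega
    have h1 : (k + 1) / p = k / p := by
      rw [h0, Nat.add_mul_div_left _ _ hp, Nat.div_eq_of_lt h, zero_add]
    have h2 : (k + 1) % p = k % p + 1 := by
      rw [h0, Nat.add_mul_mod_self_left, Nat.mod_eq_of_lt h]
    rw [wheelSeq, wheelSeq, h1, h2]
    refine Or.inl ?_
    unfold wheelTriangle
    rw [if_pos h]
    split_ifs <;> exact Sym2.eq_swap
  · have h2 : k + 1 = p * (k / p + 1) := by
      have := Nat.div_add_mod k p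
      rw [mul_add, mul_one]
      omega
    have h3 : (k + 1) / p = k / p + 1 := by rw [h2, Nat.mul_div_cancel_left _ hp]
    have h4 : (k + 1) % p = 0 := by rw [h2, Nat.mul_mod_right]
    have h5 : k % p = p - 1 := by omega
    rw [wheelSeq, wheelSeq, h3, h4]
    refine Or.inr ?_
    have h6 : s * ((k / p + 1 : ℕ) : ZMod m) = s * ((k / p : ℕ) : ZMod m) + s := by
      push_cast; ring
    have h7 : s * ((k / p + 1 : ℕ) : ZMod m) + x 0 = s * ((k / p : ℕ) : ZMod m) + x (k % p) := by
      rw [h6, h5, ← hc]; ring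
    unfold wheelTriangle
    rw [if_neg h]
    split_ifs <;> (dsimp only; rw [h7, h6])

theorem isChain_wheelStrip (hp : 0 < p) (hc : s + x 0 = x (p - 1)) (a : ℕ) :
    (wheelStrip ι p x s a).IsChain StripStep :=
  List.isChain_map_range _ _ fun k _ => wheelSeq_step ι hp hc (a + 1 + k)

theorem length_wheelStrip (a : ℕ) : (wheelStrip ι p x s a).length = m * p - 1 := by
  simp [wheelStrip]

theorem wheelSeq_add_period (hp : 0 < p) (k : ℕ) :
    wheelSeq ι p x s (k + m * p) = wheelSeq ι p x s k := by
  rw [wheelSeq, wheelSeq, Nat.add_mul_div_right _ _ hp, Nat.add_mul_mod_self_right]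
  simp

theorem head?_wheelStrip (hmp : 1 < m * p) (a : ℕ) :
    (wheelStrip ι p x s a).head? = some (wheelSeq ι p x s (a + 1)) := by
  obtain ⟨n, hn⟩ : ∃ n, m * p - 1 = n + 1 := ⟨m * p - 2, by omega⟩
  rw [wheelStrip, hn, List.head?_map_range_succ]

theorem getLast?_wheelStrip (hmp : 1 < m * p) (a : ℕ) :
    (wheelStrip ι p x s a).getLast? = some (wheelSeq ι p x s (a + m * p - 1)) := by
  obtain ⟨n, hn⟩ : ∃ n, m * p - 1 = n + 1 := ⟨m * p - 2, by omega⟩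
  rw [wheelStrip, hn, List.getLast?_map_range_succ]
  congr 2
  omega

/-- Since `s` is a unit, the hubs run through all residues, so the indices modulo m * p enumerate
all triangles. Only the index `a` is left out. -/
theorem wheelTriangle_mem_wheelStrip [NeZero m] (hs : IsUnit s) {a i : ℕ} {c : ZMod m}
    (ha : a < p) (hi : i < p) (hne : c ≠ 0 ∨ i ≠ a) :
    wheelTriangle ι p x s c i ∈ wheelStrip ι p x s a := by
  have hp : 0 < p := by omega
  obtain ⟨j, hj, rfl⟩ := ZMod.exists_eq_mul_natCast hs c
  have hseq : wheelSeq ι p x s (i + j * p) = wheelTriangle ι p x s (s * (j : ZMod m)) i := by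
    rw [wheelSeq, Nat.add_mul_div_right _ _ hp, Nat.add_mul_mod_self_right, Nat.mod_eq_of_lt hi,
      Nat.div_eq_of_lt hi, zero_add]
  have hk : i + j * p < m * p := by
    calc i + j * p < p + j * p := by omega
      _ = (j + 1) * p := by ring
      _ ≤ m * p := Nat.mul_le_mul_right _ hj
  have hpm : p ≤ m * p := Nat.le_mul_of_pos_left _ (NeZero.pos m)
  have hka : i + j * p ≠ a := by
    intro h
    rcases Nat.eq_zero_or_pos j with rfl | hj0
    · simp at hne h
      exact hne h
    · have : 1 * p ≤ j * p := Nat.mul_le_mul_right _ hj0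
      omega
  rw [← hseq]
  rcases lt_or_gt_of_ne hka with h | h
  -- An index below `a` is met one period later.
  · refine List.mem_map.2 ⟨i + j * p + m * p - a - 1, List.mem_range.2 (by omega), ?_⟩
    rw [← wheelSeq_add_period ι hp (i + j * p)]
    congr 1
    omega
  · refine List.mem_map.2 ⟨i + j * p - a - 1, List.mem_range.2 (by omega), ?_⟩
    congr 1
    omega

section Covers

variable [NeZero m] {a : ℕ}

theorem covers_wheelStrip_rim (hs : IsUnit s) (ha : a < p) {i : ℕ} (hi : i + 1 < p) {c : ZMod m}
    (hne : c ≠ 0 ∨ i ≠ a) :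
    Covers (wheelStrip ι p x s a) (ι (c + x i)) (ι (c + x (i + 1))) := by
  refine ⟨_, wheelTriangle_mem_wheelStrip ι hs ha (by omega : i < p) hne, ?_, ?_⟩ <;>
    simp [wheelTriangle, hi, triangleVertices]

/-- This edge lies in the last triangle at the hub `c`; `a + 1 < p` ensures that the deleted
triangle is not the last one at its hub. -/
theorem covers_wheelStrip_step (hs : IsUnit s) (ha : a + 1 < p) (c : ZMod m) :
    Covers (wheelStrip ι p x s a) (ι c) (ι (c + s)) := by
  refine ⟨_, wheelTriangle_mem_wheelStrip ι hs (by omega : a < p) (by omega : p - 1 < p)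
    (c := c) (Or.inr (by omega)), ?_, ?_⟩ <;>
    rw [wheelTriangle, if_neg (by omega)] <;> simp [triangleVertices]

/-- A spoke lies in two consecutive triangles, so it survives the deletion of one. For the spoke of
index 0 the other triangle is the last one at the preceding hub. -/
theorem covers_wheelStrip_spoke (hs : IsUnit s) (hc : s + x 0 = x (p - 1)) (ha : a + 1 < p)
    {i : ℕ} (hi : i < p) (c : ZMod m) :
    Covers (wheelStrip ι p x s a) (ι c) (ι (c + x i)) := by
  by_cases hne : c ≠ 0 ∨ i ≠ a
  · refine ⟨_, wheelTriangle_mem_wheelStrip ι hs (by omega : a < p) hi hne, ?_, ?_⟩ <;>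
      unfold wheelTriangle triangleVertices <;> split_ifs <;> simp
  · push Not at hne
    obtain ⟨rfl, rfl⟩ := hne
    cases i with
    | zero =>
      refine ⟨_, wheelTriangle_mem_wheelStrip ι hs (by omega : 0 < p) (by omega : p - 1 < p)
        (c := -s) (Or.inr (by omega)), ?_, ?_⟩
      all_goals
        rw [wheelTriangle, if_neg (by omega)]
        simp [triangleVertices, ← hc]
    | succ i =>
      refine ⟨_, wheelTriangle_mem_wheelStrip ι hs (by omega : i + 1 < p) (by omega : i < p)
        (c := 0) (Or.inr (by omega)), ?_, ?_⟩ <;>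
        simp [wheelTriangle, triangleVertices, show i + 1 < p by omega]

/-- A list containing a wheel strip, the missing rim edge and all translates of the elements
of `D` covers all pairs. -/
theorem IsWheel.covers (h : IsWheel p x s D) (ha : a + 1 < p) {R : V → V → Prop}
    (hR : ∀ u v, R u v → R v u)
    (hL : ∀ u v, Covers (wheelStrip ι p x s a) u v → R u v)
    (hrim : R (ι (x a)) (ι (x (a + 1)))) (hD : ∀ e ∈ D, ∀ c, R (ι c) (ι (c + e)))
    (u v : ZMod m) (huv : u ≠ v) : R (ι u) (ι v) := by
  -- Differences are classified only up to sign, which the symmetry of `R` absorbs.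
  have hdir : ∀ e : ZMod m, (∀ c, R (ι c) (ι (c + e))) → ∀ u v : ZMod m,
      (v - u = e ∨ v - u = -e) → R (ι u) (ι v) := by
    rintro e he u v (huv | huv)
    · have := he u
      rwa [← huv, add_sub_cancel] at this
    · have := he v
      rw [show v + e = u by rw [← neg_neg e, ← huv]; ring] at this
      exact hR _ _ this
  rcases h.cover (v - u) (sub_ne_zero.2 huv.symm) with ⟨i, hi, hd⟩ | ⟨i, hi, hd⟩ | hd | ⟨e, he, hd⟩
  · exact hdir _ (fun c => hL _ _ (covers_wheelStrip_spoke ι h.isUnit h.closing ha hi c)) u v hd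
  · refine hdir _ (fun c => ?_) u v hd
    by_cases hne : c - x i ≠ 0 ∨ i ≠ a
    · have := covers_wheelStrip_rim ι (x := x) h.isUnit (by omega : a < p) hi hne
      rw [sub_add_cancel, show c - x i + x (i + 1) = c + (x (i + 1) - x i) by ring] at this
      exact hL _ _ this
    -- This is the rim edge of the deleted triangle, the only edge that the strip loses.
    · push Not at hne
      obtain ⟨hc, rfl⟩ := hne
      rw [sub_eq_zero.1 hc, add_sub_cancel]
      exact hrim
  · exact hdir _ (fun c => hL _ _ (covers_wheelStrip_step ι h.isUnit ha c)) u v hd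
  · exact hdir _ (hD e he) u v hd

end Covers

end Wheel

/-! ### Opened wheels with up to three added points -/

theorem mem_simplicialDiameters_of_covers {V : Type*} [Fintype V] [DecidableEq V]
    (L : List (V × V × V)) (hL : L.IsChain StripStep) (G : Finset (Sym2 V)) (hne : L ≠ [])
    (hcov : ∀ u v, u ≠ v → s(u, v) ∈ G ∨ Covers L u v)
    (hcard : 2 * L.length + 1 + G.card ≤ (Fintype.card V).choose 2) :
    L.length - 1 ∈ simplicialDiameters (Fintype.card V) 2 :=
  mem_simplicialDiameters_of_cover L hL G hne (fun u v huv => (hcov u v huv).imp_right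
    fun ⟨t, ht, hu, hv⟩ => ⟨t, ht, mem_triangleEdges_of_mem huv hu hv⟩) hcard

theorem List.IsChain.append_of_getLast? {α : Type*} {R : α → α → Prop} {l₁ l₂ : List α} {a b : α}
    (h₁ : l₁.IsChain R) (h₂ : l₂.IsChain R) (ha : l₁.getLast? = some a) (hb : l₂.head? = some b)
    (hab : R a b) : (l₁ ++ l₂).IsChain R := by
  refine List.isChain_append.2 ⟨h₁, h₂, fun x hx y hy => ?_⟩
  rw [Option.mem_def, ha, Option.some_inj] at hx
  rw [Option.mem_def, hb, Option.some_inj] at hy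
  exact hx ▸ hy ▸ hab

theorem List.IsChain.cons_of_head? {α : Type*} {R : α → α → Prop} {l : List α} {a b : α}
    (h : l.IsChain R) (hb : l.head? = some b) (hab : R a b) : (a :: l).IsChain R :=
  List.IsChain.append_of_getLast? (l₁ := [a]) (by simp) h rfl hb hab

/-- This triangle ends the strip opened at `a = 0`; further triangles are glued to one of its edges
at the vertex 0. -/
theorem wheelSeq_last {V : Type*} {m p : ℕ} (ι : ZMod m → V) {x : ℕ → ZMod m} {s : ZMod m}
    (hm : 0 < m) (hp : 0 < p) (hc : s + x 0 = x (p - 1)) :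
    wheelSeq ι p x s (0 + m * p - 1) = (ι (-s), ι (x 0), ι 0) := by
  have h : 0 + m * p - 1 = (p - 1) + (m - 1) * p := by
    obtain ⟨m, rfl⟩ := Nat.exists_eq_succ_of_ne_zero hm.ne'
    obtain ⟨p, rfl⟩ := Nat.exists_eq_succ_of_ne_zero hp.ne'
    simp only [Nat.succ_eq_add_one, Nat.add_sub_cancel]
    ring_nf
    omega
  rw [h, wheelSeq, Nat.add_mul_div_right _ _ hp, Nat.add_mul_mod_self_right,
    Nat.mod_eq_of_lt (by omega), Nat.div_eq_of_lt (by omega), zero_add, wheelTriangle,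
    if_neg (by omega), ← hc, Nat.cast_sub (by omega : 1 ≤ m)]
  simp

theorem Nat.two_mul_choose_two (n : ℕ) : 2 * n.choose 2 = n * (n - 1) := by
  rw [Nat.choose_two_right, Nat.mul_div_cancel' (Nat.even_mul_pred_self n).two_dvd]

variable {m p : ℕ} {x : ℕ → ZMod m} {s : ZMod m}

/-- The 2p differences of the wheel are all there are. The lost rim edge is the one uncovered pair,
as C(m,2) = 2mp is even. -/
theorem IsWheel.diameter_mem [NeZero m] (hm : m = 4 * p + 1) (hp : 2 ≤ p)
    (h : IsWheel p x s []) : m * p - 2 ∈ simplicialDiameters m 2 := by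
  have hmp : 2 * 9 ≤ p * m := Nat.mul_le_mul hp (by omega)
  rw [mul_comm p m] at hmp
  have hlen := length_wheelStrip (m := m) (p := p) (x := x) (s := s) id 0
  have := mem_simplicialDiameters_of_covers (wheelStrip id p x s 0)
    (isChain_wheelStrip id (by omega) h.closing 0) {s(x 0, x 1)}
    (by intro h0; rw [h0] at hlen; simp at hlen; omega) ?_ ?_
  · rw [ZMod.card, hlen] at this
    rwa [Nat.sub_sub] at this
  · exact h.covers id (a := 0) (by omega)
      (R := fun u v => s(u, v) ∈ ({s(x 0, x 1)} : Finset (Sym2 (ZMod m))) ∨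
        Covers (wheelStrip id p x s 0) u v)
      (fun u v huv => huv.imp (fun h => by rwa [@Sym2.eq_swap _ v u]) Covers.symm)
      (fun u v huv => Or.inr huv) (Or.inl (by simp)) (by simp)
  · rw [hlen, ZMod.card, Finset.card_singleton]
    have h2 := Nat.two_mul_choose_two m
    have h3 : m * (m - 1) = 4 * (m * p) := by
      rw [show m - 1 = 4 * p by omega]; ring
    omega

/-- The inclusion of `ZMod m` into itself with `v` points added. -/
abbrev withInfinity (m v : ℕ) : ZMod m → ZMod m ⊕ Fin v := Sum.inl

theorem card_withInfinity (m v : ℕ) [NeZero m] : Fintype.card (ZMod m ⊕ Fin v) = m + v := by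
  rw [Fintype.card_sum, ZMod.card, Fintype.card_fin]

/-- Because 2d = s, the vertices -s, -d, 0 are consecutive on the cycle of difference `d` and form a
triangle that can be glued to the edge from -s to 0 at the end of the wheel. The next triangle joins
-d to the new point, and the fan covers the rest of the cycle. The rim edge stays uncovered. -/
theorem IsWheel.diameter_mem_one [NeZero m] (hm : m = 4 * p + 3) (hp : 2 ≤ p) {d : ZMod m}
    (hd : IsUnit d) (hds : d + d = s) (h : IsWheel p x s [d]) :
    m * p + m - 2 ∈ simplicialDiameters (m + 1) 2 := by
  have hmp : 2 * 11 ≤ p * m := Nat.mul_le_mul hp (by omega)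
  rw [mul_comm p m] at hmp
  let ι := withInfinity m 1
  let I : ZMod m ⊕ Fin 1 := Sum.inr 0
  have hcast : ((m - 2 : ℕ) : ZMod m) = -2 := by rw [Nat.cast_sub (by omega)]; simp
  let F := fan ι I 0 d (m - 2)
  let L : List ((ZMod m ⊕ Fin 1) × (ZMod m ⊕ Fin 1) × (ZMod m ⊕ Fin 1)) :=
    wheelStrip ι p x s 0 ++ (ι (-s), ι 0, ι (-d)) :: (ι (-d), ι 0, I) :: F
  have hlen : L.length = m * p + m - 1 := by
    simp only [L, F, List.length_append, List.length_cons, length_fan, length_wheelStrip]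
    omega
  have hchain : L.IsChain StripStep := by
    refine (isChain_wheelStrip ι (by omega) h.closing 0).append_of_getLast?
      ((((isChain_fan ι I 0 d _).cons_of_head? (b := (I, ι 0, ι (0 + d))) ?_
        ?_).cons_of_head? rfl ?_)) (getLast?_wheelStrip ι (by omega) 0) rfl ?_
    · obtain ⟨k, hk⟩ : ∃ k, m - 2 = k + 1 := ⟨m - 3, by omega⟩
      rw [hk, head?_fan_succ]
    · exact Or.inr rfl
    · exact Or.inr rfl
    · rw [wheelSeq_last ι (by omega) (by omega) h.closing]
      exact Or.inl Sym2.eq_swap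
  have hS : wheelStrip ι p x s 0 ⊆ L := List.subset_append_left _ _
  have hF : F ⊆ L := fun t ht => by simp [L, ht]
  have hA : (ι (-s), ι 0, ι (-d)) ∈ L := by simp [L]
  have hB : (ι (-d), ι 0, I) ∈ L := by simp [L]
  have happ : ∀ u, Covers L (ι u) I := by
    intro u
    obtain ⟨i, hi, rfl⟩ := ZMod.exists_eq_mul_natCast hd u
    rcases (by omega : i ≤ m - 2 ∨ i = m - 1) with hi' | rfl
    · have := covers_fan_apex ι I 0 d (by omega : 0 < m - 2) hi'
      rw [zero_add] at this
      exact (this.mono hF).symm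
    · refine ⟨_, hB, ?_, by simp [triangleVertices]⟩
      rw [Nat.cast_sub (by omega)]
      simp [triangleVertices]
  have hedge : ∀ c, Covers L (ι c) (ι (c + d)) := by
    intro c
    obtain ⟨i, hi, rfl⟩ := ZMod.exists_eq_mul_natCast hd c
    -- The fan misses only the two edges at -d.
    rcases (by omega : i < m - 2 ∨ i = m - 2 ∨ i = m - 1) with hi' | rfl | rfl
    · have := covers_fan_edge ι I 0 d hi'
      rw [zero_add] at this
      exact this.mono hF
    · refine ⟨_, hA, ?_, ?_⟩
      · rw [hcast, show d * -2 = -s by rw [← hds]; ring]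
        simp [triangleVertices]
      · rw [hcast, show d * -2 + d = -d by ring]
        simp [triangleVertices]
    · refine ⟨_, hB, ?_, ?_⟩
      all_goals
        rw [Nat.cast_sub (by omega)]
        simp [triangleVertices]
  have hWW := h.covers ι (a := 0) (by omega)
      (R := fun u v => s(u, v) ∈ ({s(ι (x 0), ι (x 1))} : Finset (Sym2 (ZMod m ⊕ Fin 1))) ∨
        Covers L u v)
      (fun u v huv => huv.imp (fun h => by rwa [@Sym2.eq_swap _ v u]) Covers.symm)
      (fun u v huv => Or.inr (huv.mono hS)) (Or.inl (by simp))
      (fun e he c => by rw [List.mem_singleton.1 he]; exact Or.inr (hedge c))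
  have := mem_simplicialDiameters_of_covers L hchain {s(ι (x 0), ι (x 1))}
    (by intro h0; rw [h0] at hlen; simp at hlen; omega) ?_ ?_
  · rw [card_withInfinity, hlen] at this
    rwa [Nat.sub_sub] at this
  · rintro (u | i) (v | j) huv
    · exact hWW u v (fun h => huv (h ▸ rfl))
    · fin_cases j
      exact Or.inr (happ u)
    · fin_cases i
      exact Or.inr (happ v).symm
    · exact absurd (by congr; exact Subsingleton.elim i j) huv
  · rw [hlen, card_withInfinity, Finset.card_singleton]
    have h2 := Nat.two_mul_choose_two (m + 1)
    have h3 : (m + 1) * (m + 1 - 1) = 4 * (m * p) + 4 * m := by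
      rw [Nat.add_sub_cancel, mul_comm, show m + 1 = 4 * p + 4 by omega]; ring
    omega

/-- Because 2d = x 0, a triangle 0, d, x 0 can be glued to the end of the wheel; the first fan
covers the rest of the cycle of difference `d`, going from 0 the other way round to x 0. There a
triangle containing both new points leads to the second fan, which covers all but one edge of the
cycle of difference `e` and ends with the edge from x 1 = x 0 - 2e to x 0 - e. The final triangle
closes this cycle and contains the lost rim edge. -/
theorem IsWheel.diameter_mem_two [NeZero m] (hm : m = 4 * p + 5) (hp : 2 ≤ p) {d e : ZMod m}
    (hd : IsUnit d) (he : IsUnit e) (hd0 : d + d = x 0) (he0 : e + e = x 0 - x 1)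
    (h : IsWheel p x s [d, e]) : m * p + 2 * m - 1 ∈ simplicialDiameters (m + 2) 2 := by
  have hmp : 2 * 13 ≤ p * m := Nat.mul_le_mul hp (by omega)
  rw [mul_comm p m] at hmp
  let ι := withInfinity m 2
  let I : Fin 2 → ZMod m ⊕ Fin 2 := Sum.inr
  have hcast : ((m - 2 : ℕ) : ZMod m) = -2 := by rw [Nat.cast_sub (by omega)]; simp
  have hcast1 : ((m - 1 : ℕ) : ZMod m) = -1 := by rw [Nat.cast_sub (by omega)]; simp
  let F₁ := fan ι (I 0) 0 (-d) (m - 2)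
  let F₂ := fan ι (I 1) (x 0) e (m - 1)
  let L : List ((ZMod m ⊕ Fin 2) × (ZMod m ⊕ Fin 2) × (ZMod m ⊕ Fin 2)) :=
    wheelStrip ι p x s 0 ++ (ι 0, ι (x 0), ι d) :: (ι d, ι 0, I 0) :: (F₁ ++
      (I 0, ι (x 0), I 1) :: (F₂ ++ [(ι (x 0 - e), ι (x 1), ι (x 0))]))
  have hlen : L.length = m * p + 2 * m := by
    simp only [L, F₁, F₂, List.length_append, List.length_cons, List.length_nil, length_fan,
      length_wheelStrip]
    omega
  obtain ⟨k₁, hk₁⟩ : ∃ k, m - 2 = k + 1 := ⟨m - 3, by omega⟩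
  obtain ⟨k₂, hk₂⟩ : ∃ k, m - 1 = k + 1 := ⟨m - 2, by omega⟩
  have hk₂' : (k₂ : ZMod m) = -2 := by
    rw [← hcast]
    congr 1
    omega
  have hchain : L.IsChain StripStep := by
    have hF₂ : (F₂ ++ [(ι (x 0 - e), ι (x 1), ι (x 0))]).IsChain StripStep := by
      refine (isChain_fan ι _ _ _ _).append_of_getLast? (List.isChain_singleton _)
        (by rw [hk₂]; exact getLast?_fan_succ _ _ _ _ _) rfl (Or.inr ?_)
      rw [← hk₂, hcast1, hk₂', show x 0 + e * -1 = x 0 - e by ring,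
        show x 0 + e * -2 = x 1 by linear_combination -he0]
    have hF₂' : (F₂ ++ [(ι (x 0 - e), ι (x 1), ι (x 0))]).head? =
        some (I 1, ι (x 0), ι (x 0 + e)) := by
      simp only [F₂, hk₂, List.head?_append, head?_fan_succ]
      rfl
    refine (isChain_wheelStrip ι (by omega) h.closing 0).append_of_getLast?
      (List.IsChain.cons_of_head? (List.IsChain.cons_of_head? (List.IsChain.append_of_getLast?
        (isChain_fan ι _ _ _ _) (hF₂.cons_of_head? hF₂' (Or.inr rfl))
        (by dsimp only [F₁]; rw [hk₁]; exact getLast?_fan_succ _ _ _ _ _) rfl (Or.inl ?_))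
        (b := (I 0, ι 0, ι (0 + -d))) ?_ (Or.inr rfl)) rfl (Or.inl rfl))
      (getLast?_wheelStrip ι (by omega) 0) rfl ?_
    · rw [← hk₁, hcast, show 0 + -d * -2 = x 0 by rw [← hd0]; ring]
      exact Sym2.eq_swap
    · simp only [F₁, hk₁, List.head?_append, head?_fan_succ]
      rfl
    · rw [wheelSeq_last ι (by omega) (by omega) h.closing]
      exact Or.inr rfl
  have hS : wheelStrip ι p x s 0 ⊆ L := List.subset_append_left _ _
  have hF₁ : F₁ ⊆ L := fun t ht => by simp [L, ht]
  have hF₂ : F₂ ⊆ L := fun t ht => by simp [L, ht]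
  have hA : (ι 0, ι (x 0), ι d) ∈ L := by simp [L]
  have hB : (ι d, ι 0, I 0) ∈ L := by simp [L]
  have hC : (I 0, ι (x 0), I 1) ∈ L := by simp [L]
  have hD : (ι (x 0 - e), ι (x 1), ι (x 0)) ∈ L := by simp [L]
  have happ₁ : ∀ u, Covers L (ι u) (I 0) := by
    intro u
    obtain ⟨i, hi, hu⟩ := ZMod.exists_eq_mul_natCast hd.neg u
    rcases (by omega : i ≤ m - 2 ∨ i = m - 1) with hi' | rfl
    · have := covers_fan_apex ι (I 0) 0 (-d) (by omega : 0 < m - 2) hi'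
      rw [zero_add, ← hu] at this
      exact (this.mono hF₁).symm
    · refine ⟨_, hB, ?_, by simp [triangleVertices]⟩
      rw [hu, hcast1]
      simp [triangleVertices]
  have happ₂ : ∀ u, Covers L (ι u) (I 1) := by
    intro u
    obtain ⟨i, hi, hu⟩ := ZMod.exists_eq_mul_natCast he (u - x 0)
    have := covers_fan_apex ι (I 1) (x 0) e (by omega : 0 < m - 1) (by omega : i ≤ m - 1)
    rw [← hu, add_sub_cancel] at this
    exact (this.mono hF₂).symm
  have hedge₁ : ∀ c, Covers L (ι c) (ι (c + d)) := by
    intro c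
    obtain ⟨i, hi, hc⟩ := ZMod.exists_eq_mul_natCast hd.neg (c + d)
    have hc' : c = -d + -d * (i : ZMod m) := by rw [← hc]; ring
    rcases (by omega : i < m - 2 ∨ i = m - 2 ∨ i = m - 1) with hi' | rfl | rfl
    · have := covers_fan_edge ι (I 0) 0 (-d) hi'
      rw [zero_add, ← hc, add_neg_cancel_right] at this
      exact (this.mono hF₁).symm
    · refine ⟨_, hA, ?_, ?_⟩
      · rw [hc', hcast, show -d + -d * -2 = d by ring]
        simp [triangleVertices]
      · rw [hc, hcast, show -d * -2 = x 0 by rw [← hd0]; ring]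
        simp [triangleVertices]
    · refine ⟨_, hB, ?_, ?_⟩
      · rw [hc', hcast1, show -d + -d * -1 = 0 by ring]
        simp [triangleVertices]
      · rw [hc, hcast1, show -d * -1 = d by ring]
        simp [triangleVertices]
  have hedge₂ : ∀ c, Covers L (ι c) (ι (c + e)) := by
    intro c
    obtain ⟨i, hi, hc⟩ := ZMod.exists_eq_mul_natCast he (c - x 0)
    rcases (by omega : i < m - 1 ∨ i = m - 1) with hi' | rfl
    · have := covers_fan_edge ι (I 1) (x 0) e hi'
      rw [← hc, add_sub_cancel] at this
      exact this.mono hF₂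
    · rw [hcast1] at hc
      refine ⟨_, hD, ?_, ?_⟩
      · rw [show c = x 0 - e by linear_combination hc]
        simp [triangleVertices]
      · rw [show c + e = x 0 by linear_combination hc]
        simp [triangleVertices]
  have hWW := h.covers ι (a := 0) (by omega) (R := Covers L) (fun u v huv => huv.symm)
    (fun u v huv => huv.mono hS)
    ⟨_, hD, by simp [triangleVertices], by simp [triangleVertices]⟩
    (by
      simp only [List.mem_cons, List.not_mem_nil, or_false]
      rintro f (rfl | rfl)
      · exact hedge₁
      · exact hedge₂)
  have := mem_simplicialDiameters_of_covers L hchain ∅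
    (by intro h0; rw [h0] at hlen; simp at hlen; omega) ?_ ?_
  · rwa [card_withInfinity, hlen] at this
  · have hII : Covers L (I 0) (I 1) :=
      ⟨_, hC, by simp [triangleVertices], by simp [triangleVertices]⟩
    rintro (u | i) (v | j) huv <;> right
    · exact hWW u v (fun h => huv (h ▸ rfl))
    · fin_cases j
      exacts [happ₁ u, happ₂ u]
    · fin_cases i
      exacts [(happ₁ v).symm, (happ₂ v).symm]
    · fin_cases i <;> fin_cases j
      exacts [absurd rfl huv, hII, hII.symm, absurd rfl huv]
  · rw [hlen, card_withInfinity, Finset.card_empty]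
    have h2 := Nat.two_mul_choose_two (m + 2)
    have h3 : (m + 2) * (m + 2 - 1) = 4 * (m * p) + 8 * m + 2 := by
      rw [show m + 2 - 1 = m + 1 by omega]
      subst hm
      ring
    omega

/-- Deleting the triangle of index 1 leaves a strip that starts from the spoke between 0 and x 2 =
3d and ends with 0, x 0, x 1, and it is extended at both ends. At the far end, the triangle x 1, x
0, x 2 recovers the rim edge and the edge from 2d to 3d, leading to the fan for `d`. At the near
end, the fans for 8d and 4d precede the wheel. The three differences are multiples of one `d`, so
that linking triangles such as 0, 4d, 8d supply the edges that the fans leave out. -/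
theorem IsWheel.diameter_mem_three [NeZero m] (hm : m = 4 * p + 7) (hp : 3 ≤ p) {d : ZMod m}
    (hd : IsUnit d) (h4 : IsUnit (4 * d)) (h8 : IsUnit (8 * d)) (hx0 : x 0 = 2 * d)
    (hx2 : x 2 = 3 * d) (h : IsWheel p x s [d, 4 * d, 8 * d]) :
    m * p + 3 * m ∈ simplicialDiameters (m + 3) 2 := by
  have hmp : 3 * 19 ≤ p * m := Nat.mul_le_mul hp (by omega)
  rw [mul_comm p m] at hmp
  let ι := withInfinity m 3
  let I : Fin 3 → ZMod m ⊕ Fin 3 := Sum.inr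
  have hcast : ∀ k ≤ m, ((m - k : ℕ) : ZMod m) = -(k : ZMod m) := by
    intro k hk
    rw [Nat.cast_sub hk]
    simp
  let F₃ := fan ι (I 2) (8 * d) (8 * d) (m - 1)
  let F₂ := fan ι (I 1) (-(8 * d)) (-(4 * d)) (m - 4)
  let F₁ := fan ι (I 0) (2 * d) (-d) (m - 2)
  let Q : List ((ZMod m ⊕ Fin 3) × (ZMod m ⊕ Fin 3) × (ZMod m ⊕ Fin 3)) :=
    (ι (x 1), ι (x 0), ι (3 * d)) :: (ι (3 * d), ι (2 * d), I 0) :: (F₁ ++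
      [(I 0, ι (4 * d), I 1), (I 0, I 1, I 2)])
  let L : List ((ZMod m ⊕ Fin 3) × (ZMod m ⊕ Fin 3) × (ZMod m ⊕ Fin 3)) :=
    F₃ ++ (ι (-(8 * d)), ι 0, ι (-(4 * d))) :: (ι (-(8 * d)), ι (-(4 * d)), I 1) :: (F₂ ++
      (I 1, ι (8 * d), ι 0) :: (ι 0, ι (8 * d), ι (4 * d)) :: (ι 0, ι (4 * d), ι (3 * d)) ::
        (wheelStrip ι p x s 1 ++ Q))
  have hlen : L.length = m * p + 3 * m + 1 := by
    simp only [L, Q, F₁, F₂, F₃, List.length_append, List.length_cons, List.length_nil, length_fan,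
      length_wheelStrip]
    omega
  obtain ⟨k₁, hk₁⟩ : ∃ k, m - 2 = k + 1 := ⟨m - 3, by omega⟩
  obtain ⟨k₂, hk₂⟩ : ∃ k, m - 4 = k + 1 := ⟨m - 5, by omega⟩
  obtain ⟨k₃, hk₃⟩ : ∃ k, m - 1 = k + 1 := ⟨m - 2, by omega⟩
  have hk₃' : (k₃ : ZMod m) = -2 := by
    rw [show k₃ = m - 2 by omega, hcast 2 (by omega)]
    rfl
  have hchain : L.IsChain StripStep := by
    have hF₁ : (F₁ ++ [(I 0, ι (4 * d), I 1), (I 0, I 1, I 2)]).IsChain StripStep := by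
      refine (isChain_fan ι _ _ _ _).append_of_getLast?
        (List.isChain_pair.2 (Or.inl Sym2.eq_swap))
        (by rw [hk₁]; exact getLast?_fan_succ _ _ _ _ _) rfl
        (Or.inl ?_)
      rw [← hk₁, hcast 2 (by omega), show 2 * d + -d * -((2 : ℕ) : ZMod m) = 4 * d by
        push_cast; ring]
      exact Sym2.eq_swap
    have hQ : Q.IsChain StripStep := by
      refine List.IsChain.cons_of_head? (List.IsChain.cons_of_head? hF₁
        (b := (I 0, ι (2 * d), ι (2 * d + -d))) ?_ (Or.inr rfl)) rfl (Or.inr ?_)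
      · simp only [F₁, hk₁, List.head?_append, head?_fan_succ]
        rfl
      · rw [hx0]
    have hSQ : (wheelStrip ι p x s 1 ++ Q).IsChain StripStep := by
      refine (isChain_wheelStrip ι (by omega) h.closing 1).append_of_getLast? hQ
        (getLast?_wheelStrip ι (by omega) 1) rfl ?_
      rw [show 1 + m * p - 1 = 0 + m * p by omega, wheelSeq_add_period ι (by omega), wheelSeq,
        Nat.zero_mod, wheelTriangle, if_pos (by omega)]
      refine Or.inr ?_
      simp
    have hSQ' : (wheelStrip ι p x s 1 ++ Q).head? =
        some (wheelTriangle ι p x s 0 2) := by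
      rw [List.head?_append, head?_wheelStrip ι (by omega)]
      simp [wheelSeq, Nat.div_eq_of_lt (by omega : 2 < p), Nat.mod_eq_of_lt (by omega : 2 < p)]
    refine (isChain_fan ι _ _ _ _).append_of_getLast?
      (List.IsChain.cons_of_head? (List.IsChain.cons_of_head? (List.IsChain.append_of_getLast?
        (isChain_fan ι _ _ _ _) (List.IsChain.cons_of_head? (List.IsChain.cons_of_head?
          (hSQ.cons_of_head? hSQ' ?_) rfl ?_) rfl ?_)
        (by dsimp only [F₂]; rw [hk₂]; exact getLast?_fan_succ _ _ _ _ _) rfl ?_)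
        (b := (I 1, ι (-(8 * d)), ι (-(8 * d) + -(4 * d)))) ?_ ?_) rfl ?_)
      (by rw [hk₃]; exact getLast?_fan_succ _ _ _ _ _) rfl ?_
    · refine Or.inl ?_
      unfold wheelTriangle
      split_ifs <;> simp [hx2, Sym2.eq_swap]
    · exact Or.inl Sym2.eq_swap
    · exact Or.inr rfl
    · refine Or.inl ?_
      rw [← hk₂, hcast 4 (by omega), show -(8 * d) + -(4 * d) * -((4 : ℕ) : ZMod m) = 8 * d by
        push_cast; ring]
      exact Sym2.eq_swap
    · simp only [F₂, hk₂, List.head?_append, head?_fan_succ]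
      rfl
    · exact Or.inl rfl
    · exact Or.inl Sym2.eq_swap
    · refine Or.inr ?_
      rw [← hk₃, hk₃', hcast 1 (by omega), show 8 * d + 8 * d * -((1 : ℕ) : ZMod m) = 0 by
        push_cast; ring, show 8 * d + 8 * d * -2 = -(8 * d) by ring]
      exact Sym2.eq_swap
  have hS : wheelStrip ι p x s 1 ⊆ L := fun t ht => by simp [L, ht]
  have hF₁ : F₁ ⊆ L := fun t ht => by simp [L, Q, ht]
  have hF₂ : F₂ ⊆ L := fun t ht => by simp [L, ht]
  have hF₃ : F₃ ⊆ L := fun t ht => by simp [L, ht]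
  have cov : ∀ t ∈ L, ∀ u v, u ∈ triangleVertices t → v ∈ triangleVertices t → Covers L u v :=
    fun t ht u v hu hv => ⟨t, ht, hu, hv⟩
  have hA := cov (ι (-(8 * d)), ι 0, ι (-(4 * d))) (by simp [L])
  have hB := cov (ι (-(8 * d)), ι (-(4 * d)), I 1) (by simp [L])
  have hC := cov (I 1, ι (8 * d), ι 0) (by simp [L])
  have hD := cov (ι 0, ι (8 * d), ι (4 * d)) (by simp [L])
  have hE := cov (ι 0, ι (4 * d), ι (3 * d)) (by simp [L])
  have hM := cov (ι (x 1), ι (x 0), ι (3 * d)) (by simp [L, Q])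
  have hN := cov (ι (3 * d), ι (2 * d), I 0) (by simp [L, Q])
  have hO := cov (I 0, ι (4 * d), I 1) (by simp [L, Q])
  have hP := cov (I 0, I 1, I 2) (by simp [L, Q])
  simp only [triangleVertices, List.mem_cons, List.not_mem_nil, or_false]
    at hA hB hC hD hE hM hN hO hP
  have happ₁ : ∀ u, Covers L (ι u) (I 0) := by
    intro u
    obtain ⟨i, hi, hu⟩ := ZMod.exists_eq_mul_natCast hd.neg (u - 2 * d)
    rcases (by omega : i ≤ m - 2 ∨ i = m - 1) with hi' | rfl
    · have := covers_fan_apex ι (I 0) (2 * d) (-d) (by omega : 0 < m - 2) hi'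
      rw [← hu, add_sub_cancel] at this
      exact (this.mono hF₁).symm
    · rw [hcast 1 (by omega)] at hu
      push_cast at hu
      rw [show u = 3 * d by linear_combination hu]
      exact hN _ _ (by simp) (by simp)
  have happ₂ : ∀ u, Covers L (ι u) (I 1) := by
    intro u
    obtain ⟨i, hi, hu⟩ := ZMod.exists_eq_mul_natCast h4.neg (u - -(8 * d))
    -- This fan stops at 8d; the linking triangles join its apex to the remaining vertices 4d, 0 and
    -- -4d.
    rcases (by omega : i ≤ m - 4 ∨ i = m - 3 ∨ i = m - 2 ∨ i = m - 1) with hi' | rfl | rfl | rfl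
    · have := covers_fan_apex ι (I 1) (-(8 * d)) (-(4 * d)) (by omega : 0 < m - 4) hi'
      rw [← hu, add_sub_cancel] at this
      exact (this.mono hF₂).symm
    all_goals
      rw [hcast _ (by omega)] at hu
      push_cast at hu
    · rw [show u = 4 * d by linear_combination hu]
      exact hO _ _ (by simp) (by simp)
    · rw [show u = 0 by linear_combination hu]
      exact hC _ _ (by simp) (by simp)
    · rw [show u = -(4 * d) by linear_combination hu]
      exact hB _ _ (by simp) (by simp)
  have happ₃ : ∀ u, Covers L (ι u) (I 2) := by
    intro u
    obtain ⟨i, hi, hu⟩ := ZMod.exists_eq_mul_natCast h8 (u - 8 * d)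
    have := covers_fan_apex ι (I 2) (8 * d) (8 * d) (by omega : 0 < m - 1) (by omega : i ≤ m - 1)
    rw [← hu, add_sub_cancel] at this
    exact (this.mono hF₃).symm
  have hedge₁ : ∀ c, Covers L (ι c) (ι (c + d)) := by
    intro c
    obtain ⟨i, hi, hc⟩ := ZMod.exists_eq_mul_natCast hd.neg (c + d - 2 * d)
    rcases (by omega : i < m - 2 ∨ i = m - 2 ∨ i = m - 1) with hi' | rfl | rfl
    · have := covers_fan_edge ι (I 0) (2 * d) (-d) hi'
      rw [← hc, add_sub_cancel, add_neg_cancel_right] at this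
      exact (this.mono hF₁).symm
    all_goals
      rw [hcast _ (by omega)] at hc
      push_cast at hc
    · rw [show c + d = 4 * d by linear_combination hc, show c = 3 * d by linear_combination hc]
      exact hE _ _ (by simp) (by simp)
    · rw [show c + d = 3 * d by linear_combination hc, show c = 2 * d by linear_combination hc]
      exact hN _ _ (by simp) (by simp)
  have hedge₂ : ∀ c, Covers L (ι c) (ι (c + 4 * d)) := by
    intro c
    obtain ⟨i, hi, hc⟩ := ZMod.exists_eq_mul_natCast h4.neg (c + 4 * d - -(8 * d))
    rcases (by omega : i < m - 4 ∨ i = m - 4 ∨ i = m - 3 ∨ i = m - 2 ∨ i = m - 1) with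
      hi' | rfl | rfl | rfl | rfl
    · have := covers_fan_edge ι (I 1) (-(8 * d)) (-(4 * d)) hi'
      rw [← hc, add_sub_cancel, add_neg_cancel_right] at this
      exact (this.mono hF₂).symm
    all_goals
      rw [hcast _ (by omega)] at hc
      push_cast at hc
    · rw [show c + 4 * d = 8 * d by linear_combination hc,
        show c = 4 * d by linear_combination hc]
      exact hD _ _ (by simp) (by simp)
    · rw [show c + 4 * d = 4 * d by linear_combination hc, show c = 0 by linear_combination hc]
      exact hD _ _ (by simp) (by simp)
    · rw [show c + 4 * d = 0 by linear_combination hc,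
        show c = -(4 * d) by linear_combination hc]
      exact hA _ _ (by simp) (by simp)
    · rw [show c + 4 * d = -(4 * d) by linear_combination hc,
        show c = -(8 * d) by linear_combination hc]
      exact hB _ _ (by simp) (by simp)
  have hedge₃ : ∀ c, Covers L (ι c) (ι (c + 8 * d)) := by
    intro c
    obtain ⟨i, hi, hc⟩ := ZMod.exists_eq_mul_natCast h8 (c - 8 * d)
    rcases (by omega : i < m - 1 ∨ i = m - 1) with hi' | rfl
    · have := covers_fan_edge ι (I 2) (8 * d) (8 * d) hi'
      rw [← hc, add_sub_cancel] at this
      exact this.mono hF₃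
    · rw [hcast _ (by omega)] at hc
      push_cast at hc
      rw [show c + 8 * d = 8 * d by linear_combination hc, show c = 0 by linear_combination hc]
      exact hC _ _ (by simp) (by simp)
  have hWW := h.covers ι (a := 1) (by omega) (R := Covers L) (fun u v huv => huv.symm)
    (fun u v huv => huv.mono hS) (by rw [hx2]; exact hM _ _ (by simp) (by simp))
    (by
      simp only [List.mem_cons, List.not_mem_nil, or_false]
      rintro f (rfl | rfl | rfl)
      exacts [hedge₁, hedge₂, hedge₃])
  have := mem_simplicialDiameters_of_covers L hchain ∅
    (by intro h0; rw [h0] at hlen; simp at hlen) ?_ ?_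
  · rwa [card_withInfinity, hlen] at this
  · have hII : ∀ i j, Covers L (I i) (I j) := by
      intro i j
      fin_cases i <;> fin_cases j <;> exact hP _ _ (by simp) (by simp)
    rintro (u | i) (v | j) huv <;> right
    · exact hWW u v (fun h => huv (h ▸ rfl))
    · fin_cases j
      exacts [happ₁ u, happ₂ u, happ₃ u]
    · fin_cases i
      exacts [(happ₁ v).symm, (happ₂ v).symm, (happ₃ v).symm]
    · exact hII i j
  · rw [hlen, card_withInfinity, Finset.card_empty]
    have h2 := Nat.two_mul_choose_two (m + 3)
    have h3 : (m + 3) * (m + 3 - 1) = 4 * (m * p) + 12 * m + 6 := by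
      rw [show m + 3 - 1 = m + 2 by omega]
      subst hm
      ring
    omega

/-! ### General sequences of spokes -/

/-- The integer `a` is one of `c`, `-c`, `m - c`, `c - m`, hence congruent to `c` or `-c`
modulo `m`. -/
def IsSignedResidue (m c a : ℤ) : Prop :=
  a = c ∨ a = -c ∨ a = m - c ∨ a = c - m

theorem IsSignedResidue.cast_eq {m : ℕ} {c a : ℤ} (h : IsSignedResidue m c a) :
    (c : ZMod m) = a ∨ (c : ZMod m) = -a := by
  rcases h with rfl | rfl | rfl | rfl <;> simp

/-- Up to sign every nonzero residue has a representative between 1 and m / 2, so the covering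
condition becomes linear arithmetic over the integers. -/
theorem IsWheel.of_int {m p : ℕ} [NeZero m] {y : ℕ → ℤ} {s : ℤ} {D : List (ZMod m)}
    (hs : IsUnit (s : ZMod m)) (hc : s + y 0 = y (p - 1))
    (hcov : ∀ c : ℕ, 1 ≤ c → 2 * c ≤ m → (∃ i < p, IsSignedResidue m c (y i)) ∨
      (∃ i, i + 1 < p ∧ IsSignedResidue m c (y (i + 1) - y i)) ∨ IsSignedResidue m c s ∨
      ∃ e : ℤ, (e : ZMod m) ∈ D ∧ IsSignedResidue m c e) :
    IsWheel p (fun i => (y i : ZMod m)) s D where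
  isUnit := hs
  closing := by rw [← hc]; push_cast; rfl
  cover := by
    have key : ∀ c : ℕ, 1 ≤ c → 2 * c ≤ m → ∀ d : ZMod m, (d = (c : ℤ) ∨ d = -((c : ℤ) : ZMod m)) →
        (∃ i < p, d = y i ∨ d = -(y i : ZMod m)) ∨
        (∃ i, i + 1 < p ∧ (d = y (i + 1) - y i ∨ d = -((y (i + 1) : ZMod m) - y i))) ∨
        (d = s ∨ d = -(s : ZMod m)) ∨ ∃ e ∈ D, d = e ∨ d = -e := by
      intro c h1 h2 d hd
      have aux : ∀ a : ℤ, IsSignedResidue m c a → d = a ∨ d = -(a : ZMod m) := by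
        intro a ha
        rcases ha.cast_eq with h | h <;> rcases hd with hd | hd <;> rw [hd, h] <;> simp
      rcases hcov c h1 h2 with ⟨i, hi, h⟩ | ⟨i, hi, h⟩ | h | ⟨e, he, h⟩
      · exact Or.inl ⟨i, hi, aux _ h⟩
      · have := aux _ h
        push_cast at this
        exact Or.inr (Or.inl ⟨i, hi, this⟩)
      · exact Or.inr (Or.inr (Or.inl (aux _ h)))
      · exact Or.inr (Or.inr (Or.inr ⟨_, he, aux _ h⟩))
    intro d hd
    have hv : 0 < d.val := Nat.pos_of_ne_zero fun h => hd ((ZMod.val_eq_zero d).1 h)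
    have hlt := ZMod.val_lt d
    by_cases h : 2 * d.val ≤ m
    · refine key d.val hv h d (Or.inl ?_)
      simp
    · refine key (m - d.val) (by omega) (by omega) d (Or.inr ?_)
      simp [Nat.cast_sub hlt.le]

/-- The zigzag p + 1, 2p, p + 2, 2p - 1, … has differences p - 1, p - 2, …, 2, and its terms fill
the interval from p + 1 to 2p except p + l + 2. The last term 1 supplies itself and, by its
difference to the preceding term, this gap; `s` supplies p. -/
theorem mem_simplicialDiameters_four_mul_add_one_of_odd {p l : ℕ} (hp : p = 2 * l + 3) :
    (4 * p + 1) * p - 2 ∈ simplicialDiameters (4 * p + 1) 2 := by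
  have h0 : ((4 * p + 1 : ℕ) : ZMod (4 * p + 1)) = 0 := ZMod.natCast_self _
  push_cast at h0
  obtain ⟨y, ha, heven, hodd⟩ : ∃ y : ℕ → ℤ, y (2 * l + 2) = 1 ∧
      (∀ j : ℕ, j ≤ l → y (2 * j) = p + 1 + j) ∧
      ∀ j : ℕ, j ≤ l → y (2 * j + 1) = 2 * p - j := by
    refine ⟨fun i =>
      if i = 2 * l + 2 then 1 else
      if i % 2 = 0 then p + 1 + (i / 2 : ℤ) else 2 * p - ((i - 1 : ℤ) / 2), ?_, ?_, ?_⟩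
    all_goals
      intros
      beta_reduce
      split_ifs <;> first | contradiction | omega
  refine IsWheel.diameter_mem (x := fun i => (y i : ZMod (4 * p + 1))) rfl (by omega)
    (IsWheel.of_int (y := y) (s := -p) ?_ ?_ ?_)
  · exact .of_mul_eq_one (4) (by push_cast; linear_combination -h0)
  · rw [show p - 1 = 2 * l + 2 by omega]
    have hy0 : y 0 = _ := heven 0 (by omega)
    omega
  · intro c h1 h2
    rcases (by omega : c = 1 ∨ (2 ≤ c ∧ c ≤ p - 1 ∧ c % 2 = 0) ∨ (2 ≤ c ∧ c ≤ p - 1 ∧ c % 2 = 1) ∨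
      c = p ∨ (p + 1 ≤ c ∧ c ≤ p + l + 1) ∨ c = p + l + 2 ∨ p + l + 3 ≤ c) with
      h | h | h | h | h | h | h
    · refine .inl ⟨2 * l + 2, by omega, ?_⟩
      rw [ha]
      exact Or.inl (by omega)
    · obtain ⟨j, hj⟩ : ∃ j, (p - 1 - c) / 2 = j := ⟨_, rfl⟩
      refine .inr (.inl ⟨2 * j, by omega, ?_⟩)
      rw [show y (2 * j + 1) = _ from hodd j (by omega), heven j (by omega)]
      exact Or.inl (by omega)
    · obtain ⟨j, hj⟩ : ∃ j, (p - 2 - c) / 2 = j := ⟨_, rfl⟩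
      refine .inr (.inl ⟨2 * j + 1, by omega, ?_⟩)
      rw [show y (2 * j + 1 + 1) = _ from heven (j + 1) (by omega), hodd j (by omega)]
      exact Or.inr (Or.inl (by omega))
    · exact .inr (.inr (.inl (Or.inr (Or.inl (by omega)))))
    · obtain ⟨j, hj⟩ : ∃ j, c - p - 1 = j := ⟨_, rfl⟩
      refine .inl ⟨2 * j, by omega, ?_⟩
      rw [heven j (by omega)]
      exact Or.inl (by omega)
    · refine .inr (.inl ⟨2 * l + 1, by omega, ?_⟩)
      rw [show y (2 * l + 1 + 1) = _ from ha, hodd l (by omega)]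
      exact Or.inr (Or.inl (by omega))
    · obtain ⟨j, hj⟩ : ∃ j, 2 * p - c = j := ⟨_, rfl⟩
      refine .inl ⟨2 * j + 1, by omega, ?_⟩
      rw [hodd j (by omega)]
      exact Or.inl (by omega)

/-- Here the zigzag is 2p, p + 2, 2p - 1, …. The initial term p - 1 also yields the difference p +
1, and the last term -1 yields the gap p + l + 3. -/
theorem mem_simplicialDiameters_four_mul_add_one_of_even {p l : ℕ} (hp : p = 2 * l + 4) :
    (4 * p + 1) * p - 2 ∈ simplicialDiameters (4 * p + 1) 2 := by
  have h0 : ((4 * p + 1 : ℕ) : ZMod (4 * p + 1)) = 0 := ZMod.natCast_self _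
  push_cast at h0
  obtain ⟨y, ha, hb, heven, hodd⟩ : ∃ y : ℕ → ℤ, y 0 = p - 1 ∧
      y (2 * l + 3) = -1 ∧
      (∀ j : ℕ, j ≤ l → y (2 * j + 2) = p + 2 + j) ∧
      ∀ j : ℕ, j ≤ l → y (2 * j + 1) = 2 * p - j := by
    refine ⟨fun i =>
      if i = 0 then p - 1 else
      if i = 2 * l + 3 then -1 else
      if i % 2 = 0 then p + 2 + ((i - 2 : ℤ) / 2) else 2 * p - ((i - 1 : ℤ) / 2), ?_, ?_, ?_, ?_⟩
    all_goals
      intros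
      beta_reduce
      split_ifs <;> first | contradiction | omega
  refine IsWheel.diameter_mem (x := fun i => (y i : ZMod (4 * p + 1))) rfl (by omega)
    (IsWheel.of_int (y := y) (s := -p) ?_ ?_ ?_)
  · exact .of_mul_eq_one (4) (by push_cast; linear_combination -h0)
  · rw [show p - 1 = 2 * l + 3 by omega]
    omega
  · intro c h1 h2
    rcases (by omega : c = 1 ∨ (2 ≤ c ∧ c ≤ p - 2 ∧ c % 2 = 0) ∨ (2 ≤ c ∧ c ≤ p - 2 ∧ c % 2 = 1) ∨
      c = p - 1 ∨ c = p ∨ c = p + 1 ∨ (p + 2 ≤ c ∧ c ≤ p + l + 2) ∨ c = p + l + 3 ∨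
        p + l + 4 ≤ c) with
      h | h | h | h | h | h | h | h | h
    · refine .inl ⟨2 * l + 3, by omega, ?_⟩
      rw [hb]
      exact Or.inr (Or.inl (by omega))
    · obtain ⟨j, hj⟩ : ∃ j, (p - 2 - c) / 2 = j := ⟨_, rfl⟩
      refine .inr (.inl ⟨2 * j + 1, by omega, ?_⟩)
      rw [show y (2 * j + 1 + 1) = _ from heven j (by omega), hodd j (by omega)]
      exact Or.inr (Or.inl (by omega))
    · obtain ⟨j, hj⟩ : ∃ j, (p - 3 - c) / 2 = j := ⟨_, rfl⟩
      refine .inr (.inl ⟨2 * j + 2, by omega, ?_⟩)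
      rw [show y (2 * j + 2 + 1) = _ from hodd (j + 1) (by omega), heven j (by omega)]
      exact Or.inl (by omega)
    · refine .inl ⟨0, by omega, ?_⟩
      rw [ha]
      exact Or.inl (by omega)
    · exact .inr (.inr (.inl (Or.inr (Or.inl (by omega)))))
    · refine .inr (.inl ⟨0, by omega, ?_⟩)
      rw [show y (0 + 1) = _ from hodd 0 (by omega), ha]
      exact Or.inl (by omega)
    · obtain ⟨j, hj⟩ : ∃ j, c - p - 2 = j := ⟨_, rfl⟩
      refine .inl ⟨2 * j + 2, by omega, ?_⟩
      rw [heven j (by omega)]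
      exact Or.inl (by omega)
    · refine .inr (.inl ⟨2 * l + 2, by omega, ?_⟩)
      rw [show y (2 * l + 2 + 1) = _ from hb, heven l (by omega)]
      exact Or.inr (Or.inl (by omega))
    · obtain ⟨j, hj⟩ : ∃ j, 2 * p - c = j := ⟨_, rfl⟩
      refine .inl ⟨2 * j + 1, by omega, ?_⟩
      rw [hodd j (by omega)]
      exact Or.inl (by omega)

/-- The class p + 1 is left to the fan; its double is -(2p + 1) modulo 4p + 3, which dictates `s`.
-/
theorem mem_simplicialDiameters_four_mul_add_four_of_even {p l : ℕ} (hp : p = 2 * l + 4) :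
    (4 * p + 3) * p + (4 * p + 3) - 2 ∈ simplicialDiameters (4 * p + 3 + 1) 2 := by
  have h0 : ((4 * p + 3 : ℕ) : ZMod (4 * p + 3)) = 0 := ZMod.natCast_self _
  push_cast at h0
  obtain ⟨y, ha, hb, heven, hodd⟩ : ∃ y : ℕ → ℤ, y (2 * l + 2) = 1 ∧
      y (2 * l + 3) = -(p - 1) ∧
      (∀ j : ℕ, j ≤ l → y (2 * j) = p + 2 + j) ∧
      ∀ j : ℕ, j ≤ l → y (2 * j + 1) = 2 * p - j := by
    refine ⟨fun i =>
      if i = 2 * l + 2 then 1 else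
      if i = 2 * l + 3 then -(p - 1) else
      if i % 2 = 0 then p + 2 + (i / 2 : ℤ) else 2 * p - ((i - 1 : ℤ) / 2), ?_, ?_, ?_, ?_⟩
    all_goals
      intros
      beta_reduce
      split_ifs <;> first | contradiction | omega
  refine IsWheel.diameter_mem_one (x := fun i => (y i : ZMod (4 * p + 3))) rfl (by omega)
    (d := ((p + 1 : ℤ) : ZMod (4 * p + 3)))
    (.of_mul_eq_one 4 (by push_cast; linear_combination h0))
    (by push_cast; linear_combination h0)
    (IsWheel.of_int (y := y) (s := -(2 * p + 1)) ?_ ?_ ?_)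
  · exact .of_mul_eq_one (2) (by push_cast; linear_combination -h0)
  · rw [show p - 1 = 2 * l + 3 by omega]
    have hy0 : y 0 = _ := heven 0 (by omega)
    omega
  · intro c h1 h2
    rcases (by omega : c = 1 ∨ (2 ≤ c ∧ c ≤ p - 2 ∧ c % 2 = 0) ∨ (2 ≤ c ∧ c ≤ p - 2 ∧ c % 2 = 1) ∨
      c = p - 1 ∨ c = p ∨ c = p + 1 ∨ (p + 2 ≤ c ∧ c ≤ p + l + 2) ∨ c = p + l + 3 ∨
        (p + l + 4 ≤ c ∧ c ≤ 2 * p) ∨ c = 2 * p + 1) with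
      h | h | h | h | h | h | h | h | h | h
    · refine .inl ⟨2 * l + 2, by omega, ?_⟩
      rw [ha]
      exact Or.inl (by omega)
    · obtain ⟨j, hj⟩ : ∃ j, (p - 2 - c) / 2 = j := ⟨_, rfl⟩
      refine .inr (.inl ⟨2 * j, by omega, ?_⟩)
      rw [show y (2 * j + 1) = _ from hodd j (by omega), heven j (by omega)]
      exact Or.inl (by omega)
    · obtain ⟨j, hj⟩ : ∃ j, (p - 3 - c) / 2 = j := ⟨_, rfl⟩
      refine .inr (.inl ⟨2 * j + 1, by omega, ?_⟩)
      rw [show y (2 * j + 1 + 1) = _ from heven (j + 1) (by omega), hodd j (by omega)]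
      exact Or.inr (Or.inl (by omega))
    · refine .inl ⟨2 * l + 3, by omega, ?_⟩
      rw [hb]
      exact Or.inr (Or.inl (by omega))
    · refine .inr (.inl ⟨2 * l + 2, by omega, ?_⟩)
      rw [show y (2 * l + 2 + 1) = _ from hb, ha]
      exact Or.inr (Or.inl (by omega))
    · exact .inr (.inr (.inr ⟨p + 1, by simp, Or.inl (by omega)⟩))
    · obtain ⟨j, hj⟩ : ∃ j, c - p - 2 = j := ⟨_, rfl⟩
      refine .inl ⟨2 * j, by omega, ?_⟩
      rw [heven j (by omega)]
      exact Or.inl (by omega)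
    · refine .inr (.inl ⟨2 * l + 1, by omega, ?_⟩)
      rw [show y (2 * l + 1 + 1) = _ from ha, hodd l (by omega)]
      exact Or.inr (Or.inl (by omega))
    · obtain ⟨j, hj⟩ : ∃ j, 2 * p - c = j := ⟨_, rfl⟩
      refine .inl ⟨2 * j + 1, by omega, ?_⟩
      rw [hodd j (by omega)]
      exact Or.inl (by omega)
    · exact .inr (.inr (.inl (Or.inr (Or.inl (by omega)))))

theorem mem_simplicialDiameters_four_mul_add_four_of_odd {p l : ℕ} (hp : p = 2 * l + 3) :
    (4 * p + 3) * p + (4 * p + 3) - 2 ∈ simplicialDiameters (4 * p + 3 + 1) 2 := by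
  have h0 : ((4 * p + 3 : ℕ) : ZMod (4 * p + 3)) = 0 := ZMod.natCast_self _
  push_cast at h0
  obtain ⟨y, ha, hb, heven, hodd⟩ : ∃ y : ℕ → ℤ, y (2 * l + 1) = -1 ∧
      y (2 * l + 2) = -p ∧
      (∀ j : ℕ, j ≤ l → y (2 * j) = p + 2 + j) ∧
      ∀ j : ℕ, j < l → y (2 * j + 1) = 2 * p - j := by
    refine ⟨fun i =>
      if i = 2 * l + 1 then -1 else
      if i = 2 * l + 2 then -p else
      if i % 2 = 0 then p + 2 + (i / 2 : ℤ) else 2 * p - ((i - 1 : ℤ) / 2), ?_, ?_, ?_, ?_⟩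
    all_goals
      intros
      beta_reduce
      split_ifs <;> first | contradiction | omega
  refine IsWheel.diameter_mem_one (x := fun i => (y i : ZMod (4 * p + 3))) rfl (by omega)
    (d := ((-(p + 1) : ℤ) : ZMod (4 * p + 3)))
    (.of_mul_eq_one (-4) (by push_cast; linear_combination h0))
    (by push_cast; ring)
    (IsWheel.of_int (y := y) (s := -(2 * p + 2)) ?_ ?_ ?_)
  · exact .of_mul_eq_one (-2) (by push_cast; linear_combination h0)
  · rw [show p - 1 = 2 * l + 2 by omega]
    have hy0 : y 0 = _ := heven 0 (by omega)
    omega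
  · intro c h1 h2
    rcases (by omega : c = 1 ∨ (2 ≤ c ∧ c ≤ p - 2 ∧ c % 2 = 1) ∨ (2 ≤ c ∧ c ≤ p - 2 ∧ c % 2 = 0) ∨
      c = p - 1 ∨ c = p ∨ c = p + 1 ∨ (p + 2 ≤ c ∧ c ≤ p + l + 2) ∨ c = p + l + 3 ∨
        (p + l + 4 ≤ c ∧ c ≤ 2 * p) ∨ c = 2 * p + 1) with
      h | h | h | h | h | h | h | h | h | h
    · refine .inl ⟨2 * l + 1, by omega, ?_⟩
      rw [ha]
      exact Or.inr (Or.inl (by omega))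
    · obtain ⟨j, hj⟩ : ∃ j, (p - 2 - c) / 2 = j := ⟨_, rfl⟩
      refine .inr (.inl ⟨2 * j, by omega, ?_⟩)
      rw [show y (2 * j + 1) = _ from hodd j (by omega), heven j (by omega)]
      exact Or.inl (by omega)
    · obtain ⟨j, hj⟩ : ∃ j, (p - 3 - c) / 2 = j := ⟨_, rfl⟩
      refine .inr (.inl ⟨2 * j + 1, by omega, ?_⟩)
      rw [show y (2 * j + 1 + 1) = _ from heven (j + 1) (by omega), hodd j (by omega)]
      exact Or.inr (Or.inl (by omega))
    · refine .inr (.inl ⟨2 * l + 1, by omega, ?_⟩)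
      rw [show y (2 * l + 1 + 1) = _ from hb, ha]
      exact Or.inr (Or.inl (by omega))
    · refine .inl ⟨2 * l + 2, by omega, ?_⟩
      rw [hb]
      exact Or.inr (Or.inl (by omega))
    · exact .inr (.inr (.inr ⟨-(p + 1), by simp, Or.inr (Or.inl (by omega))⟩))
    · obtain ⟨j, hj⟩ : ∃ j, c - p - 2 = j := ⟨_, rfl⟩
      refine .inl ⟨2 * j, by omega, ?_⟩
      rw [heven j (by omega)]
      exact Or.inl (by omega)
    · refine .inr (.inl ⟨2 * l, by omega, ?_⟩)
      rw [show y (2 * l + 1) = _ from ha, heven l (by omega)]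
      exact Or.inr (Or.inl (by omega))
    · obtain ⟨j, hj⟩ : ∃ j, 2 * p - c = j := ⟨_, rfl⟩
      refine .inl ⟨2 * j + 1, by omega, ?_⟩
      rw [hodd j (by omega)]
      exact Or.inl (by omega)
    · exact .inr (.inr (.inl (Or.inr (Or.inr (Or.inr (by omega))))))

/-- The classes 2p + 2 and 2 are left to the fans. The first two terms are dictated by them: 2p + 2
is half of -1, and -2 is half of -1 - 3. -/
theorem mem_simplicialDiameters_four_mul_add_seven_of_even {p l : ℕ} (hp : p = 2 * l + 6) :
    (4 * p + 5) * p + 2 * (4 * p + 5) - 1 ∈ simplicialDiameters (4 * p + 5 + 2) 2 := by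
  have h0 : ((4 * p + 5 : ℕ) : ZMod (4 * p + 5)) = 0 := ZMod.natCast_self _
  push_cast at h0
  obtain ⟨y, ha, hb, hc, hd, heven, hodd⟩ : ∃ y : ℕ → ℤ, y 0 = -1 ∧
      y 1 = 3 ∧
      y (2 * l + 4) = -(3 * l + 12) ∧
      y (2 * l + 5) = p ∧
      (∀ j : ℕ, j ≤ l → y (2 * j + 2) = p + l + 7 + j) ∧
      ∀ j : ℕ, j ≤ l → y (2 * j + 3) = p + l + 2 - j := by
    refine ⟨fun i =>
      if i = 0 then -1 else
      if i = 1 then 3 else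
      if i = 2 * l + 4 then -(3 * l + 12) else
      if i = 2 * l + 5 then p else
      if i % 2 = 0 then p + l + 7 + ((i - 2 : ℤ) / 2) else p + l + 2 - ((i - 3 : ℤ) / 2), ?_, ?_,
        ?_, ?_, ?_, ?_⟩
    all_goals
      intros
      beta_reduce
      split_ifs <;> first | contradiction | omega
  refine IsWheel.diameter_mem_two (x := fun i => (y i : ZMod (4 * p + 5))) rfl (by omega)
    (d := ((2 * p + 2 : ℤ) : ZMod (4 * p + 5)))
    (e := ((-2 : ℤ) : ZMod (4 * p + 5)))
    (.of_mul_eq_one (-2) (by push_cast; linear_combination -h0))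
    (.of_mul_eq_one (2 * p + 2) (by push_cast; linear_combination -h0))
    (by rw [ha]; push_cast; linear_combination h0)
    (by rw [ha, hb]; push_cast; ring)
    (IsWheel.of_int (y := y) (s := p + 1) ?_ ?_ ?_)
  · exact .of_mul_eq_one (-4) (by push_cast; linear_combination -h0)
  · rw [show p - 1 = 2 * l + 5 by omega]
    omega
  · intro c h1 h2
    rcases (by omega : c = 1 ∨ c = 2 ∨ c = 3 ∨ c = 4 ∨ (5 ≤ c ∧ c ≤ p - 1 ∧ c % 2 = 1) ∨
      (5 ≤ c ∧ c ≤ p - 1 ∧ c % 2 = 0) ∨ c = p ∨ c = p + 1 ∨ (p + 2 ≤ c ∧ c ≤ p + l + 2) ∨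
        c = p + l + 3 ∨ c = p + l + 4 ∨ c = p + l + 5 ∨ c = p + l + 6 ∨
          (p + l + 7 ≤ c ∧ c ≤ 2 * p + 1) ∨ c = 2 * p + 2) with
      h | h | h | h | h | h | h | h | h | h | h | h | h | h | h
    · refine .inl ⟨0, by omega, ?_⟩
      rw [ha]
      exact Or.inr (Or.inl (by omega))
    · exact .inr (.inr (.inr ⟨-2, by simp, Or.inr (Or.inl (by omega))⟩))
    · refine .inl ⟨1, by omega, ?_⟩
      rw [hb]
      exact Or.inl (by omega)
    · refine .inr (.inl ⟨0, by omega, ?_⟩)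
      rw [show y (0 + 1) = _ from hb, ha]
      exact Or.inl (by omega)
    · obtain ⟨j, hj⟩ : ∃ j, (c - 5) / 2 = j := ⟨_, rfl⟩
      refine .inr (.inl ⟨2 * j + 2, by omega, ?_⟩)
      rw [show y (2 * j + 2 + 1) = _ from hodd j (by omega), heven j (by omega)]
      exact Or.inr (Or.inl (by omega))
    · obtain ⟨j, hj⟩ : ∃ j, (c - 6) / 2 = j := ⟨_, rfl⟩
      refine .inr (.inl ⟨2 * j + 3, by omega, ?_⟩)
      rw [show y (2 * j + 3 + 1) = _ from heven (j + 1) (by omega), hodd j (by omega)]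
      exact Or.inl (by omega)
    · refine .inl ⟨2 * l + 5, by omega, ?_⟩
      rw [hd]
      exact Or.inl (by omega)
    · exact .inr (.inr (.inl (Or.inl (by omega))))
    · obtain ⟨j, hj⟩ : ∃ j, p + l + 2 - c = j := ⟨_, rfl⟩
      refine .inl ⟨2 * j + 3, by omega, ?_⟩
      rw [hodd j (by omega)]
      exact Or.inl (by omega)
    · refine .inr (.inl ⟨2 * l + 3, by omega, ?_⟩)
      rw [show y (2 * l + 3 + 1) = _ from hc, hodd l (by omega)]
      exact Or.inr (Or.inr (Or.inr (by omega)))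
    · refine .inr (.inl ⟨1, by omega, ?_⟩)
      rw [show y (1 + 1) = _ from heven 0 (by omega), hb]
      exact Or.inl (by omega)
    · refine .inr (.inl ⟨2 * l + 4, by omega, ?_⟩)
      rw [show y (2 * l + 4 + 1) = _ from hd, hc]
      exact Or.inr (Or.inr (Or.inl (by omega)))
    · refine .inl ⟨2 * l + 4, by omega, ?_⟩
      rw [hc]
      exact Or.inr (Or.inl (by omega))
    · obtain ⟨j, hj⟩ : ∃ j, c - (p + l + 7) = j := ⟨_, rfl⟩
      refine .inl ⟨2 * j + 2, by omega, ?_⟩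
      rw [heven j (by omega)]
      exact Or.inl (by omega)
    · exact .inr (.inr (.inr ⟨2 * p + 2, by simp, Or.inl (by omega)⟩))

theorem mem_simplicialDiameters_four_mul_add_seven_of_odd {p l : ℕ} (hp : p = 2 * l + 7) :
    (4 * p + 5) * p + 2 * (4 * p + 5) - 1 ∈ simplicialDiameters (4 * p + 5 + 2) 2 := by
  have h0 : ((4 * p + 5 : ℕ) : ZMod (4 * p + 5)) = 0 := ZMod.natCast_self _
  push_cast at h0
  obtain ⟨y, ha, hb, hc, hd, he, heven, hodd⟩ : ∃ y : ℕ → ℤ, y 0 = -1 ∧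
      y 1 = 3 ∧
      y (2 * l + 4) = -(p - 1) ∧
      y (2 * l + 5) = 3 * l + 13 ∧
      y (2 * l + 6) = -(p + 2) ∧
      (∀ j : ℕ, j ≤ l → y (2 * j + 2) = p + 3 + j) ∧
      ∀ j : ℕ, j ≤ l → y (2 * j + 3) = 2 * p + 1 - j := by
    refine ⟨fun i =>
      if i = 0 then -1 else
      if i = 1 then 3 else
      if i = 2 * l + 4 then -(p - 1) else
      if i = 2 * l + 5 then 3 * l + 13 else
      if i = 2 * l + 6 then -(p + 2) else
      if i % 2 = 0 then p + 3 + ((i - 2 : ℤ) / 2) else 2 * p + 1 - ((i - 3 : ℤ) / 2), ?_, ?_, ?_,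
        ?_, ?_, ?_, ?_⟩
    all_goals
      intros
      beta_reduce
      split_ifs <;> first | contradiction | omega
  refine IsWheel.diameter_mem_two (x := fun i => (y i : ZMod (4 * p + 5))) rfl (by omega)
    (d := ((2 * p + 2 : ℤ) : ZMod (4 * p + 5)))
    (e := ((-2 : ℤ) : ZMod (4 * p + 5)))
    (.of_mul_eq_one (-2) (by push_cast; linear_combination -h0))
    (.of_mul_eq_one (2 * p + 2) (by push_cast; linear_combination -h0))
    (by rw [ha]; push_cast; linear_combination h0)
    (by rw [ha, hb]; push_cast; ring)
    (IsWheel.of_int (y := y) (s := -(p + 1)) ?_ ?_ ?_)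
  · exact .of_mul_eq_one (4) (by push_cast; linear_combination -h0)
  · rw [show p - 1 = 2 * l + 6 by omega]
    omega
  · intro c h1 h2
    rcases (by omega : c = 1 ∨ c = 2 ∨ c = 3 ∨ c = 4 ∨ (5 ≤ c ∧ c ≤ p - 2 ∧ c % 2 = 1) ∨
      (5 ≤ c ∧ c ≤ p - 2 ∧ c % 2 = 0) ∨ c = p - 1 ∨ c = p ∨ c = p + 1 ∨ c = p + 2 ∨
        (p + 3 ≤ c ∧ c ≤ p + l + 3) ∨ c = p + l + 4 ∨ c = p + l + 5 ∨ c = p + l + 6 ∨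
          c = p + l + 7 ∨ (p + l + 8 ≤ c ∧ c ≤ 2 * p + 1) ∨ c = 2 * p + 2) with
      h | h | h | h | h | h | h | h | h | h | h | h | h | h | h | h | h
    · refine .inl ⟨0, by omega, ?_⟩
      rw [ha]
      exact Or.inr (Or.inl (by omega))
    · exact .inr (.inr (.inr ⟨-2, by simp, Or.inr (Or.inl (by omega))⟩))
    · refine .inl ⟨1, by omega, ?_⟩
      rw [hb]
      exact Or.inl (by omega)
    · refine .inr (.inl ⟨0, by omega, ?_⟩)
      rw [show y (0 + 1) = _ from hb, ha]
      exact Or.inl (by omega)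
    · obtain ⟨j, hj⟩ : ∃ j, (p - c - 2) / 2 = j := ⟨_, rfl⟩
      refine .inr (.inl ⟨2 * j + 2, by omega, ?_⟩)
      rw [show y (2 * j + 2 + 1) = _ from hodd j (by omega), heven j (by omega)]
      exact Or.inl (by omega)
    · obtain ⟨j, hj⟩ : ∃ j, (p - c - 3) / 2 = j := ⟨_, rfl⟩
      refine .inr (.inl ⟨2 * j + 3, by omega, ?_⟩)
      rw [show y (2 * j + 3 + 1) = _ from heven (j + 1) (by omega), hodd j (by omega)]
      exact Or.inr (Or.inl (by omega))
    · refine .inl ⟨2 * l + 4, by omega, ?_⟩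
      rw [hc]
      exact Or.inr (Or.inl (by omega))
    · refine .inr (.inl ⟨1, by omega, ?_⟩)
      rw [show y (1 + 1) = _ from heven 0 (by omega), hb]
      exact Or.inl (by omega)
    · exact .inr (.inr (.inl (Or.inr (Or.inl (by omega)))))
    · refine .inl ⟨2 * l + 6, by omega, ?_⟩
      rw [he]
      exact Or.inr (Or.inl (by omega))
    · obtain ⟨j, hj⟩ : ∃ j, c - (p + 3) = j := ⟨_, rfl⟩
      refine .inl ⟨2 * j + 2, by omega, ?_⟩
      rw [heven j (by omega)]
      exact Or.inl (by omega)
    · refine .inr (.inl ⟨2 * l + 5, by omega, ?_⟩)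
      rw [show y (2 * l + 5 + 1) = _ from he, hd]
      exact Or.inr (Or.inr (Or.inr (by omega)))
    · refine .inr (.inl ⟨2 * l + 3, by omega, ?_⟩)
      rw [show y (2 * l + 3 + 1) = _ from hc, hodd l (by omega)]
      exact Or.inr (Or.inr (Or.inr (by omega)))
    · refine .inl ⟨2 * l + 5, by omega, ?_⟩
      rw [hd]
      exact Or.inl (by omega)
    · refine .inr (.inl ⟨2 * l + 4, by omega, ?_⟩)
      rw [show y (2 * l + 4 + 1) = _ from hd, hc]
      exact Or.inr (Or.inr (Or.inl (by omega)))
    · obtain ⟨j, hj⟩ : ∃ j, 2 * p + 1 - c = j := ⟨_, rfl⟩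
      refine .inl ⟨2 * j + 3, by omega, ?_⟩
      rw [hodd j (by omega)]
      exact Or.inl (by omega)
    · exact .inr (.inr (.inr ⟨2 * p + 2, by simp, Or.inl (by omega)⟩))

-- For d = 2p + 3 one has 2d = -1, 3d = 2p + 2, 4d = -2 and 8d = -4. This fixes x 0 and x 2 and
-- leaves the classes 2p + 3, 2 and 4 to the fans.
set_option maxHeartbeats 400000 in
theorem mem_simplicialDiameters_four_mul_add_ten_of_even {p l : ℕ} (hp : p = 2 * l + 8) :
    (4 * p + 7) * p + 3 * (4 * p + 7) ∈ simplicialDiameters (4 * p + 7 + 3) 2 := by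
  have h0 : ((4 * p + 7 : ℕ) : ZMod (4 * p + 7)) = 0 := ZMod.natCast_self _
  push_cast at h0
  obtain ⟨y, ha, hb, hc, hd, he, hf, heven, hodd⟩ : ∃ y : ℕ → ℤ, y 0 = -1 ∧
      y 1 = p - 2 ∧
      y (2 * l + 4) = -(p + 1) ∧
      y (2 * l + 5) = 3 * l + 16 ∧
      y (2 * l + 6) = -p ∧
      y (2 * l + 7) = -(p + 3) ∧
      (∀ j : ℕ, j ≤ l → y (2 * j + 2) = 2 * p + 2 - j) ∧
      ∀ j : ℕ, j ≤ l → y (2 * j + 3) = p + 5 + j := by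
    refine ⟨fun i =>
      if i = 0 then -1 else
      if i = 1 then p - 2 else
      if i = 2 * l + 4 then -(p + 1) else
      if i = 2 * l + 5 then 3 * l + 16 else
      if i = 2 * l + 6 then -p else
      if i = 2 * l + 7 then -(p + 3) else
      if i % 2 = 0 then 2 * p + 2 - ((i - 2 : ℤ) / 2) else p + 5 + ((i - 3 : ℤ) / 2), ?_, ?_, ?_,
        ?_, ?_, ?_, ?_, ?_⟩
    all_goals
      intros
      beta_reduce
      split_ifs <;> first | contradiction | omega
  refine IsWheel.diameter_mem_three (x := fun i => (y i : ZMod (4 * p + 7))) rfl (by omega)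
    (d := ((2 * p + 3 : ℤ) : ZMod (4 * p + 7)))
    (.of_mul_eq_one (-2) (by push_cast; linear_combination -h0))
    (.of_mul_eq_one (2 * p + 3) (by push_cast; linear_combination (4 * p + 5) * h0))
    (.of_mul_eq_one (-(p + 2)) (by push_cast; linear_combination (-4 * p - 7) * h0))
    (by rw [ha]; push_cast; linear_combination -h0)
    (by rw [show y 2 = _ from heven 0 (by omega)]; push_cast; linear_combination -h0)
    (IsWheel.of_int (y := y) (s := -(p + 2)) ?_ ?_ ?_)
  · exact .of_mul_eq_one (-4) (by push_cast; linear_combination h0)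
  · rw [show p - 1 = 2 * l + 7 by omega]
    omega
  · intro c h1 h2
    rcases (by omega : c = 1 ∨ c = 2 ∨ c = 3 ∨ c = 4 ∨ (5 ≤ c ∧ c ≤ p - 3 ∧ c % 2 = 1) ∨
      (5 ≤ c ∧ c ≤ p - 3 ∧ c % 2 = 0) ∨ c = p - 2 ∨ c = p - 1 ∨ c = p ∨ c = p + 1 ∨ c = p + 2 ∨
        c = p + 3 ∨ c = p + 4 ∨ (p + 5 ≤ c ∧ c ≤ p + l + 5) ∨ c = p + l + 6 ∨ c = p + l + 7 ∨
          c = p + l + 8 ∨ c = p + l + 9 ∨ (p + l + 10 ≤ c ∧ c ≤ 2 * p + 2) ∨ c = 2 * p + 3) with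
      h | h | h | h | h | h | h | h | h | h | h | h | h | h | h | h | h | h | h | h
    · refine .inl ⟨0, by omega, ?_⟩
      rw [ha]
      exact Or.inr (Or.inl (by omega))
    · exact .inr (.inr (.inr ⟨-2, by
        have : ((-2 : ℤ) : ZMod (4 * p + 7)) = 4 * ((2 * p + 3 : ℤ) : ZMod (4 * p + 7)) := by
          push_cast
          linear_combination -2 * h0
        simp only [this, List.mem_cons, true_or, or_true], Or.inr (Or.inl (by omega))⟩))
    · refine .inr (.inl ⟨2 * l + 6, by omega, ?_⟩)
      rw [show y (2 * l + 6 + 1) = _ from hf, he]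
      exact Or.inr (Or.inl (by omega))
    · exact .inr (.inr (.inr ⟨-4, by
        have : ((-4 : ℤ) : ZMod (4 * p + 7)) = 8 * ((2 * p + 3 : ℤ) : ZMod (4 * p + 7)) := by
          push_cast
          linear_combination -4 * h0
        simp only [this, List.mem_cons, true_or, or_true], Or.inr (Or.inl (by omega))⟩))
    · obtain ⟨j, hj⟩ : ∃ j, (p - 3 - c) / 2 = j := ⟨_, rfl⟩
      refine .inr (.inl ⟨2 * j + 2, by omega, ?_⟩)
      rw [show y (2 * j + 2 + 1) = _ from hodd j (by omega), heven j (by omega)]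
      exact Or.inr (Or.inl (by omega))
    · obtain ⟨j, hj⟩ : ∃ j, (p - 4 - c) / 2 = j := ⟨_, rfl⟩
      refine .inr (.inl ⟨2 * j + 3, by omega, ?_⟩)
      rw [show y (2 * j + 3 + 1) = _ from heven (j + 1) (by omega), hodd j (by omega)]
      exact Or.inl (by omega)
    · refine .inl ⟨1, by omega, ?_⟩
      rw [hb]
      exact Or.inl (by omega)
    · refine .inr (.inl ⟨0, by omega, ?_⟩)
      rw [show y (0 + 1) = _ from hb, ha]
      exact Or.inl (by omega)
    · refine .inl ⟨2 * l + 6, by omega, ?_⟩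
      rw [he]
      exact Or.inr (Or.inl (by omega))
    · refine .inl ⟨2 * l + 4, by omega, ?_⟩
      rw [hc]
      exact Or.inr (Or.inl (by omega))
    · exact .inr (.inr (.inl (Or.inr (Or.inl (by omega)))))
    · refine .inl ⟨2 * l + 7, by omega, ?_⟩
      rw [hf]
      exact Or.inr (Or.inl (by omega))
    · refine .inr (.inl ⟨1, by omega, ?_⟩)
      rw [show y (1 + 1) = _ from heven 0 (by omega), hb]
      exact Or.inl (by omega)
    · obtain ⟨j, hj⟩ : ∃ j, c - (p + 5) = j := ⟨_, rfl⟩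
      refine .inl ⟨2 * j + 3, by omega, ?_⟩
      rw [hodd j (by omega)]
      exact Or.inl (by omega)
    · refine .inr (.inl ⟨2 * l + 4, by omega, ?_⟩)
      rw [show y (2 * l + 4 + 1) = _ from hd, hc]
      exact Or.inr (Or.inr (Or.inl (by omega)))
    · refine .inr (.inl ⟨2 * l + 5, by omega, ?_⟩)
      rw [show y (2 * l + 5 + 1) = _ from he, hd]
      exact Or.inr (Or.inr (Or.inr (by omega)))
    · refine .inl ⟨2 * l + 5, by omega, ?_⟩
      rw [hd]
      exact Or.inl (by omega)
    · refine .inr (.inl ⟨2 * l + 3, by omega, ?_⟩)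
      rw [show y (2 * l + 3 + 1) = _ from hc, hodd l (by omega)]
      exact Or.inr (Or.inr (Or.inr (by omega)))
    · obtain ⟨j, hj⟩ : ∃ j, 2 * p + 2 - c = j := ⟨_, rfl⟩
      refine .inl ⟨2 * j + 2, by omega, ?_⟩
      rw [heven j (by omega)]
      exact Or.inl (by omega)
    · exact .inr (.inr (.inr ⟨2 * p + 3, by simp, Or.inl (by omega)⟩))

set_option maxHeartbeats 400000 in
theorem mem_simplicialDiameters_four_mul_add_ten_of_odd {p l : ℕ} (hp : p = 2 * l + 7) :
    (4 * p + 7) * p + 3 * (4 * p + 7) ∈ simplicialDiameters (4 * p + 7 + 3) 2 := by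
  have h0 : ((4 * p + 7 : ℕ) : ZMod (4 * p + 7)) = 0 := ZMod.natCast_self _
  push_cast at h0
  -- Here `s` is expressed through `l`, so checking its inverse -8 needs the relation between p and
  -- l.
  have hl : (p : ZMod (4 * p + 7)) = 2 * l + 7 := by exact_mod_cast congrArg Nat.cast hp
  obtain ⟨y, ha, hb, hc, hd, he, heven, hodd⟩ : ∃ y : ℕ → ℤ, y 0 = -1 ∧
      y 1 = p ∧
      y (2 * l + 4) = -(3 * l + 14) ∧
      y (2 * l + 5) = 3 * l + 15 ∧
      y (2 * l + 6) = 3 * l + 12 ∧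
      (∀ j : ℕ, j ≤ l → y (2 * j + 2) = 2 * p + 2 - j) ∧
      ∀ j : ℕ, j ≤ l → y (2 * j + 3) = p + 4 + j := by
    refine ⟨fun i =>
      if i = 0 then -1 else
      if i = 1 then p else
      if i = 2 * l + 4 then -(3 * l + 14) else
      if i = 2 * l + 5 then 3 * l + 15 else
      if i = 2 * l + 6 then 3 * l + 12 else
      if i % 2 = 0 then 2 * p + 2 - ((i - 2 : ℤ) / 2) else p + 4 + ((i - 3 : ℤ) / 2), ?_, ?_, ?_,
        ?_, ?_, ?_, ?_⟩
    all_goals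
      intros
      beta_reduce
      split_ifs <;> first | contradiction | omega
  refine IsWheel.diameter_mem_three (x := fun i => (y i : ZMod (4 * p + 7))) rfl (by omega)
    (d := ((2 * p + 3 : ℤ) : ZMod (4 * p + 7)))
    (.of_mul_eq_one (-2) (by push_cast; linear_combination -h0))
    (.of_mul_eq_one (2 * p + 3) (by push_cast; linear_combination (4 * p + 5) * h0))
    (.of_mul_eq_one (-(p + 2)) (by push_cast; linear_combination (-4 * p - 7) * h0))
    (by rw [ha]; push_cast; linear_combination -h0)
    (by rw [show y 2 = _ from heven 0 (by omega)]; push_cast; linear_combination -h0)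
    (IsWheel.of_int (y := y) (s := 3 * l + 13) ?_ ?_ ?_)
  · exact .of_mul_eq_one (-8) (by push_cast; linear_combination -3 * h0 + 12 * hl)
  · rw [show p - 1 = 2 * l + 6 by omega]
    omega
  · intro c h1 h2
    rcases (by omega : c = 1 ∨ c = 2 ∨ c = 3 ∨ c = 4 ∨ (5 ≤ c ∧ c ≤ p - 2 ∧ c % 2 = 1) ∨
      (5 ≤ c ∧ c ≤ p - 2 ∧ c % 2 = 0) ∨ c = p - 1 ∨ c = p ∨ c = p + 1 ∨ c = p + 2 ∨ c = p + 3 ∨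
        (p + 4 ≤ c ∧ c ≤ p + l + 4) ∨ c = p + l + 5 ∨ c = p + l + 6 ∨ c = p + l + 7 ∨
          c = p + l + 8 ∨ (p + l + 9 ≤ c ∧ c ≤ 2 * p + 2) ∨ c = 2 * p + 3) with
      h | h | h | h | h | h | h | h | h | h | h | h | h | h | h | h | h | h
    · refine .inl ⟨0, by omega, ?_⟩
      rw [ha]
      exact Or.inr (Or.inl (by omega))
    · exact .inr (.inr (.inr ⟨-2, by
        have : ((-2 : ℤ) : ZMod (4 * p + 7)) = 4 * ((2 * p + 3 : ℤ) : ZMod (4 * p + 7)) := by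
          push_cast
          linear_combination -2 * h0
        simp only [this, List.mem_cons, true_or, or_true], Or.inr (Or.inl (by omega))⟩))
    · refine .inr (.inl ⟨2 * l + 5, by omega, ?_⟩)
      rw [show y (2 * l + 5 + 1) = _ from he, hd]
      exact Or.inr (Or.inl (by omega))
    · exact .inr (.inr (.inr ⟨-4, by
        have : ((-4 : ℤ) : ZMod (4 * p + 7)) = 8 * ((2 * p + 3 : ℤ) : ZMod (4 * p + 7)) := by
          push_cast
          linear_combination -4 * h0
        simp only [this, List.mem_cons, true_or, or_true], Or.inr (Or.inl (by omega))⟩))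
    · obtain ⟨j, hj⟩ : ∃ j, (p - c - 2) / 2 = j := ⟨_, rfl⟩
      refine .inr (.inl ⟨2 * j + 2, by omega, ?_⟩)
      rw [show y (2 * j + 2 + 1) = _ from hodd j (by omega), heven j (by omega)]
      exact Or.inr (Or.inl (by omega))
    · obtain ⟨j, hj⟩ : ∃ j, (p - c - 3) / 2 = j := ⟨_, rfl⟩
      refine .inr (.inl ⟨2 * j + 3, by omega, ?_⟩)
      rw [show y (2 * j + 3 + 1) = _ from heven (j + 1) (by omega), hodd j (by omega)]
      exact Or.inl (by omega)
    · refine .inr (.inl ⟨2 * l + 4, by omega, ?_⟩)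
      rw [show y (2 * l + 4 + 1) = _ from hd, hc]
      exact Or.inr (Or.inr (Or.inl (by omega)))
    · refine .inl ⟨1, by omega, ?_⟩
      rw [hb]
      exact Or.inl (by omega)
    · refine .inr (.inl ⟨0, by omega, ?_⟩)
      rw [show y (0 + 1) = _ from hb, ha]
      exact Or.inl (by omega)
    · refine .inr (.inl ⟨1, by omega, ?_⟩)
      rw [show y (1 + 1) = _ from heven 0 (by omega), hb]
      exact Or.inl (by omega)
    · refine .inr (.inl ⟨2 * l + 3, by omega, ?_⟩)
      rw [show y (2 * l + 3 + 1) = _ from hc, hodd l (by omega)]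
      exact Or.inr (Or.inr (Or.inr (by omega)))
    · obtain ⟨j, hj⟩ : ∃ j, c - (p + 4) = j := ⟨_, rfl⟩
      refine .inl ⟨2 * j + 3, by omega, ?_⟩
      rw [hodd j (by omega)]
      exact Or.inl (by omega)
    · refine .inl ⟨2 * l + 6, by omega, ?_⟩
      rw [he]
      exact Or.inl (by omega)
    · exact .inr (.inr (.inl (Or.inl (by omega))))
    · refine .inl ⟨2 * l + 4, by omega, ?_⟩
      rw [hc]
      exact Or.inr (Or.inl (by omega))
    · refine .inl ⟨2 * l + 5, by omega, ?_⟩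
      rw [hd]
      exact Or.inl (by omega)
    · obtain ⟨j, hj⟩ : ∃ j, 2 * p + 2 - c = j := ⟨_, rfl⟩
      refine .inl ⟨2 * j + 2, by omega, ?_⟩
      rw [heven j (by omega)]
      exact Or.inl (by omega)
    · exact .inr (.inr (.inr ⟨2 * p + 3, by simp, Or.inl (by omega)⟩))

/-! ### Individual wheels below the range of the general sequences -/

/-- With the indices ranging over `Fin` types and the inverse `t` of `s` given, concrete wheels are
checked by evaluation. -/
theorem IsWheel.of_fin {m p : ℕ} {x : ℕ → ZMod m} {s : ZMod m} {D : List (ZMod m)} (t : ZMod m)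
    (hs : s * t = 1) (hc : s + x 0 = x (p - 1))
    (hcov : ∀ d : ZMod m, d ≠ 0 → (∃ i : Fin p, d = x i ∨ d = -x i) ∨
      (∃ i : Fin (p - 1), d = x (i + 1) - x i ∨ d = -(x (i + 1) - x i)) ∨ (d = s ∨ d = -s) ∨
      ∃ e ∈ D, d = e ∨ d = -e) : IsWheel p x s D where
  isUnit := .of_mul_eq_one t hs
  closing := hc
  cover d hd := by
    rcases hcov d hd with ⟨i, hi⟩ | ⟨i, hi⟩ | h
    · exact Or.inl ⟨i, i.2, hi⟩
    · exact Or.inr (Or.inl ⟨i, by omega, hi⟩)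
    · exact Or.inr (Or.inr h)

theorem diameter_mem_19 : 17 * 3 + 2 * 17 - 1 ∈ simplicialDiameters 19 2 :=
  IsWheel.diameter_mem_two (m := 17) (p := 3) (x := fun i => [1, 4, 6].getD i 0) (s := 5)
    (d := 9) (e := 7) rfl (by omega) (.of_mul_eq_one 2 (by decide)) (.of_mul_eq_one 5 (by decide))
    (by decide) (by decide) (.of_fin 7 (by decide) (by decide) (by decide +kernel))

theorem diameter_mem_23 : 21 * 4 + 2 * 21 - 1 ∈ simplicialDiameters 23 2 :=
  IsWheel.diameter_mem_two (m := 21) (p := 4) (x := fun i => [1, 14, 9, 3].getD i 0) (s := 2)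
    (d := 11) (e := 4) rfl (by omega) (.of_mul_eq_one 2 (by decide))
    (.of_mul_eq_one 16 (by decide)) (by decide) (by decide)
    (.of_fin 11 (by decide) (by decide) (by decide +kernel))

theorem diameter_mem_27 : 25 * 5 + 2 * 25 - 1 ∈ simplicialDiameters 27 2 :=
  IsWheel.diameter_mem_two (m := 25) (p := 5) (x := fun i => [1, 4, 23, 18, 10].getD i 0) (s := 9)
    (d := 13) (e := 11) rfl (by omega) (.of_mul_eq_one 2 (by decide))
    (.of_mul_eq_one 16 (by decide)) (by decide) (by decide)
    (.of_fin 14 (by decide) (by decide) (by decide +kernel))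

theorem diameter_mem_30 : 27 * 5 + 3 * 27 ∈ simplicialDiameters 30 2 :=
  IsWheel.diameter_mem_three (m := 27) (p := 5) (x := fun i => [2, 12, 3, 16, 22].getD i 0)
    (s := 20) (d := 1) rfl (by omega) (.of_mul_eq_one 1 (by decide))
    (.of_mul_eq_one 7 (by decide)) (.of_mul_eq_one 17 (by decide)) (by decide) (by decide)
    (.of_fin 23 (by decide) (by decide) (by decide +kernel))

theorem diameter_mem_34 : 31 * 6 + 3 * 31 ∈ simplicialDiameters 34 2 :=
  IsWheel.diameter_mem_three (m := 31) (p := 6) (x := fun i => [2, 12, 3, 20, 25, 18].getD i 0)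
    (s := 16) (d := 1) rfl (by omega) (.of_mul_eq_one 1 (by decide))
    (.of_mul_eq_one 8 (by decide)) (.of_mul_eq_one 4 (by decide)) (by decide) (by decide)
    (.of_fin 2 (by decide) (by decide) (by decide +kernel))

/-! ### Assembly over the residues of n modulo 4 -/

/-- The two alternatives are C(n,2) = 2D + 3 and C(n,2) = 2D + 4, that is, no pair or one pair
uncovered; both round down to `D`. -/
theorem mem_simplicialDiameters_of_two_mul {n D : ℕ} (hD : D ∈ simplicialDiameters n 2)
    (h : n * (n - 1) = 4 * D + 6 ∨ n * (n - 1) = 4 * D + 8) :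
    (n.choose 2 - 3) / 2 ∈ simplicialDiameters n 2 := by
  have := Nat.two_mul_choose_two n
  rwa [show (n.choose 2 - 3) / 2 = D by omega]

theorem choose_two_mem_of_eq_four_mul_add_one {p : ℕ} (hp : 1 ≤ p) :
    ((4 * p + 1).choose 2 - 3) / 2 ∈ simplicialDiameters (4 * p + 1) 2 := by
  rcases (by omega : p = 1 ∨ p = 2 ∨ p = 2 * ((p - 3) / 2) + 3 ∨
    p = 2 * ((p - 4) / 2) + 4) with rfl | rfl | hl | hl
  · exact diameter_mem_5
  · exact diameter_mem_9
  all_goals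
    refine mem_simplicialDiameters_of_two_mul (D := (4 * p + 1) * p - 2) ?_ (Or.inr ?_)
  · exact mem_simplicialDiameters_four_mul_add_one_of_odd hl
  · have := Nat.mul_le_mul (by omega : 2 ≤ 4 * p + 1) hp
    rw [Nat.add_sub_cancel, show (4 * p + 1) * (4 * p) = 4 * ((4 * p + 1) * p) by ring]
    omega
  · exact mem_simplicialDiameters_four_mul_add_one_of_even hl
  · have := Nat.mul_le_mul (by omega : 2 ≤ 4 * p + 1) hp
    rw [Nat.add_sub_cancel, show (4 * p + 1) * (4 * p) = 4 * ((4 * p + 1) * p) by ring]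
    omega

theorem choose_two_mem_of_eq_four_mul_add_four (p : ℕ) :
    ((4 * p + 4).choose 2 - 3) / 2 ∈ simplicialDiameters (4 * p + 4) 2 := by
  rcases (by omega : p = 0 ∨ p = 1 ∨ p = 2 ∨ p = 2 * ((p - 3) / 2) + 3 ∨
    p = 2 * ((p - 4) / 2) + 4) with
    rfl | rfl | rfl | h
  · exact diameter_mem_4
  · exact diameter_mem_8
  · exact diameter_mem_12
  · refine mem_simplicialDiameters_of_two_mul (D := (4 * p + 3) * p + (4 * p + 3) - 2) ?_
      (Or.inr ?_)
    · rcases h with hl | hl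
      · exact mem_simplicialDiameters_four_mul_add_four_of_odd hl
      · exact mem_simplicialDiameters_four_mul_add_four_of_even hl
    · rw [show 4 * p + 4 - 1 = 4 * p + 3 by omega, show (4 * p + 4) * (4 * p + 3) =
        4 * ((4 * p + 3) * p + (4 * p + 3)) by ring]
      omega

theorem choose_two_mem_of_eq_four_mul_add_seven (p : ℕ) :
    ((4 * p + 7).choose 2 - 3) / 2 ∈ simplicialDiameters (4 * p + 7) 2 := by
  rcases (by omega : p = 0 ∨ p = 1 ∨ p = 2 ∨ p = 3 ∨ p = 4 ∨ p = 5 ∨ p = 2 * ((p - 6) / 2) + 6 ∨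
    p = 2 * ((p - 7) / 2) + 7) with rfl | rfl | rfl | rfl | rfl | rfl | h
  · exact diameter_mem_7
  · exact diameter_mem_11
  · exact diameter_mem_15
  · exact diameter_mem_19
  · exact diameter_mem_23
  · exact diameter_mem_27
  · refine mem_simplicialDiameters_of_two_mul (D := (4 * p + 5) * p + 2 * (4 * p + 5) - 1) ?_
      (Or.inl ?_)
    · rcases h with hl | hl
      · exact mem_simplicialDiameters_four_mul_add_seven_of_even hl
      · exact mem_simplicialDiameters_four_mul_add_seven_of_odd hl
    · rw [show 4 * p + 7 - 1 = 4 * p + 6 by omega, show (4 * p + 7) * (4 * p + 6) =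
        4 * ((4 * p + 5) * p + 2 * (4 * p + 5)) + 2 by ring]
      omega

theorem choose_two_mem_of_eq_four_mul_add_ten (p : ℕ) :
    ((4 * p + 10).choose 2 - 3) / 2 ∈ simplicialDiameters (4 * p + 10) 2 := by
  rcases (by omega : p = 0 ∨ p = 1 ∨ p = 2 ∨ p = 3 ∨ p = 4 ∨ p = 5 ∨ p = 6 ∨
    p = 2 * ((p - 7) / 2) + 7 ∨ p = 2 * ((p - 8) / 2) + 8) with
    rfl | rfl | rfl | rfl | rfl | rfl | rfl | h
  · exact diameter_mem_10
  · exact diameter_mem_14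
  · exact diameter_mem_18
  · exact diameter_mem_22
  · exact diameter_mem_26
  · exact diameter_mem_30
  · exact diameter_mem_34
  · refine mem_simplicialDiameters_of_two_mul (D := (4 * p + 7) * p + 3 * (4 * p + 7)) ?_
      (Or.inl ?_)
    · rcases h with hl | hl
      · exact mem_simplicialDiameters_four_mul_add_ten_of_odd hl
      · exact mem_simplicialDiameters_four_mul_add_ten_of_even hl
    · rw [show 4 * p + 10 - 1 = 4 * p + 9 by omega]
      ring

theorem choose_two_mem_simplicialDiameters {n : ℕ} (hn : 3 ≤ n) (h6 : n ≠ 6) :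
    (n.choose 2 - 3) / 2 ∈ simplicialDiameters n 2 := by
  -- The progressions modulo 4 start at 4, 5, 7 and 10, so they omit exactly 3, treated separately,
  -- and the excluded 6.
  rcases (by omega : n = 3 ∨ n = 4 * ((n - 1) / 4) + 1 ∨ n = 4 * ((n - 4) / 4) + 4 ∨
    n = 4 * ((n - 7) / 4) + 7 ∨ n = 4 * ((n - 10) / 4) + 10) with rfl | h | h | h | h
  · exact diameter_mem_3
  · rw [h]; exact choose_two_mem_of_eq_four_mul_add_one (by omega)
  · rw [h]; exact choose_two_mem_of_eq_four_mul_add_four _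
  · rw [h]; exact choose_two_mem_of_eq_four_mul_add_seven _
  · rw [h]; exact choose_two_mem_of_eq_four_mul_add_ten _

theorem isGreatest_simplicialDiameters {n : ℕ} (hn : 3 ≤ n) (h6 : n ≠ 6) :
    IsGreatest (simplicialDiameters n 2) ((n.choose 2 - 3) / 2) := by
  refine ⟨choose_two_mem_simplicialDiameters hn h6, fun D hD => ?_⟩
  have := le_of_mem_simplicialDiameters hD
  omega

theorem isGreatest_simplicialDiameters_six : IsGreatest (simplicialDiameters 6 2) 5 := by
  refine ⟨diameter_mem_6, fun D hD => ?_⟩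
  have h := le_of_mem_simplicialDiameters hD
  rw [show Nat.choose 6 2 = 15 from rfl] at h
  have : D ≠ 6 := fun h => six_notMem_simplicialDiameters_six (h ▸ hD)
  omega

theorem theorem1p1 (n : ℕ) (hn : 3 ≤ n) :
    IsGreatest (simplicialDiameters n 2) (Hs n 2) ∧
    (n ≠ 6 → (Hs n 2 : ℤ) = ⌊(1 / 2 : ℚ) * (n.choose 2 : ℚ) - 3 / 2⌋) ∧
    (n = 6 → Hs n 2 = 5 ∧
      (Hs n 2 : ℤ) = ⌊(1 / 2 : ℚ) * (n.choose 2 : ℚ) - 3 / 2⌋ - 1) := by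
  by_cases h6 : n = 6
  · subst h6
    have h : Hs 6 2 = 5 := isGreatest_simplicialDiameters_six.csSup_eq
    refine ⟨h ▸ isGreatest_simplicialDiameters_six, fun h => absurd rfl h, fun _ => ⟨h, ?_⟩⟩
    rw [h, show Nat.choose 6 2 = 15 from rfl, show (1 / 2 : ℚ) * ((15 : ℕ) : ℚ) - 3 / 2 = (6 : ℤ) by
      norm_num, Int.floor_intCast]
    norm_num
  · have hg := isGreatest_simplicialDiameters hn h6
    have h : Hs n 2 = (n.choose 2 - 3) / 2 := hg.csSup_eq
    refine ⟨h ▸ hg, fun _ => ?_, fun h => absurd h h6⟩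
    -- Hence the natural subtraction in the formula is not truncated.
    have h3 : 3 ≤ n.choose 2 := Nat.choose_le_choose 2 hn
    have h1 : 2 * Hs n 2 + 3 ≤ n.choose 2 := by omega
    have h2 : n.choose 2 < 2 * Hs n 2 + 5 := by omega
    have h1' : (2 * Hs n 2 + 3 : ℚ) ≤ n.choose 2 := by exact_mod_cast h1
    have h2' : (n.choose 2 : ℚ) < 2 * Hs n 2 + 5 := by exact_mod_cast h2
    symm
    rw [Int.floor_eq_iff, Int.cast_natCast]
    constructor <;> linarith
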